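/- \textbf{Model.} Let $d,N^\Phi,N^\Psi\ge 0$. Consider real commuting fields $\Phi_1,\dots,\Phi_{N^\Phi}$ and real anticommuting fields $\Psi_1,\dots,\Psi_{N^\Psi}$ on $\mathbb R^{1+d}$ with metric $\mathrm{diag}(-1,1,\dots,1)$, put $\Xi=(\Phi|\Psi)$, and let the Lagrange density be $$\tfrac12\bigl(-\partial_\mu\Phi_i\partial^\mu\Phi_i-m^\Phi_{ij}\Phi_i\Phi_j+i\,\partial_\mu\Psi_k\Gamma^\mu_{kl}\Psi_l+i\,\Psi_k m^\Psi_{kl}\Psi_l\bigr)+\mathcal V'(\Xi)+\mathcal V^{\mu,i}(\Xi)\,\partial_\mu\Phi_i ,$$ where $m^\Phi,\Gamma^\mu$ are real symmetric, $m^\Psi$ is real antisymmetric, and $\mathcal V'$, $\mathcal V^{\mu,i}$ are real, even, entire power series in $\Xi$ of lower degree $\ge 3$ and $\ge 2$. (A power series $\sum P_{\alpha\beta}y^\alpha\eta^\beta$ in commuting $y$ and anticommuting $\eta$ is entire if for every $R>0$ there is $C>0$ with $|P_{\alpha\beta}|\le CR^{-|\alpha|}$ for all $\alpha,\beta$; it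 is real if it is invariant under the antilinear conjugation that fixes the variables and reverses products.) Let $D=i(-\Gamma^\mu\partial_\mu+m^\Psi)$, and suppose that there are a first-order operator $K=K(\partial_t,\partial_a)$ with constant complex matrix coefficients and a real matrix $M$ with $KD=\square+M$, where $\square=-\partial_t^2+\Delta$. Put $\mathcal V^{\mu,ij}=\partial\mathcal V^{\mu,j}/\partial\Phi_i-\partial\mathcal V^{\mu,i}/\partial\Phi_j$ and $\mathcal V=\mathcal V'+\mathcal V^{\mu,i}\partial_\mu\Phi_i$. The first-order system of the model, in the commuting components $\Phi_i,\dot\Phi_i$ and the anticommuting components $\Psi_j$, is $$\partial_t\Phi_i=\dot\Phi_i,\qquad \partial_t\dot\Phi_i=\Delta\Phi_i-m^\Phi_{ij}\Phi_j+\frac{\partial\mathcal V'}{\partial\Phi_i}(\Xi)+\mathcal V^{\mu,ij}(\Xi)\,\partial_\mu\Phi_j,$$ $$\partial_t\Psi_i=-\bigl((\Gamma^0)^{-1}\bigr)_{ij}\Bigl(\Gamma^a_{jk}\partial_a\Psi_k-m^\Psi_{jk}\Psi_k+i\frac{\partial\mathcal V}{\partial\Psi_j}\Bigr),$$ where $\partial_0\Phi_j$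 on the right-hand sides stands for $\dot\Phi_j$, and $\partial/\partial\Psi_j$ is the left derivative. \textbf{Class of systems.} Consider a system $\partial_t\Xi_i=\sum_jK_{ij}(\partial_x)\Xi_j+\Delta_i[\Xi]$ on $\mathbb R\times\mathbb R^d$ for finitely many commuting and anticommuting components, with real constant-coefficient spatial differential operators $K_{ij}(\partial_x)$ and power series $\Delta_i$ in the variables $\partial_x^\nu\Xi_j$. Its Fourier-transformed influence function $\hat A(t,p)$ is the solution of $\partial_t\hat A=K(ip)\hat A$, $\hat A(0,p)=(2\pi)^{-d/2}1$. The system belongs to the class with integer smoothness offsets $\tau=(\tau_i)$ if: $K_{ij}=0$ whenever the components $i,j$ have different parity; each $\Delta_i$ is real, entire, of lower degree $\ge2$ and of the parity of $\Xi_i$; $\Delta_i$ contains $\partial_x^\nu\Xi_j$ only if $|\nu|\le\tau_j-\tau_i$; and for each $T>0$ there is $C>0$ with $|\hat A_{ij}(t,p)|\le C(1+|p|)^{\tau_j-\tau_i}$ for all $i,j$, all $p\in\mathbb R^d$ and all $|t|\le T$. The system is causal if the inverse spatial Fourier transform $A(t,x)$ of $\hat A(t,p)$ (a tempered distribution in $x$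 for every $t$) satisfies $\operatorname{supp}A\subseteq\{(t,x):|x|\le|t|\}$. \textbf{Lemma.} The first-order system of the model belongs to this class, with smoothness offsets $1$ for the $\Phi_i$ and $0$ for the $\dot\Phi_i$ and the $\Psi_j$, and it is causal. Moreover, its influence function is $\hat A=\mathrm{diag}(\hat A^\Phi,\hat A^\Psi)$ with $$\hat A^\Phi=\begin{pmatrix}\partial_t\hat{\mathcal A}^\Phi&\hat{\mathcal A}^\Phi\\ \partial_t^2\hat{\mathcal A}^\Phi&\partial_t\hat{\mathcal A}^\Phi\end{pmatrix},\qquad \hat{\mathcal A}^\Phi(t,p)=(2\pi)^{-d/2}\,\frac{\sin t\sqrt{p^2+m^\Phi}}{\sqrt{p^2+m^\Phi}},$$ $$\hat A^\Psi(t,p)\,(M-p^2)=(2\pi)^{-d/2}\,\bigl[K(\partial_t,ip)\cos t\sqrt{p^2-M^{\mathsf T}}\,\bigr]\,D(0,ip)$$ for every $K,M$ as above (functions of matrices being defined by their everywhere convergent power series), and there is $C>0$ such that for all $t\in(-1,1)$ and $p\in\mathbb R^d$, entry by entry, $$|\hat{\mathcal A}^\Phi|\le\frac C{1+|p|},\qquad|\partial_t\hat{\mathcal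 A}^\Phi|\le C,\qquad|\partial_t^2\hat{\mathcal A}^\Phi|\le C(1+|p|),\qquad|\hat A^\Psi|\le C .$$ -/

import Mathlib

open scoped Matrix SchwartzMap

noncomputable section

/-! ### Formal power series in commuting and anticommuting variables -/

/-- Formal power series `∑ P_{α,S} y^α η^S` with complex coefficients in commuting variables
`y_i` (`i : σ`) and anticommuting variables `η_k` (`k : ι`).  The index type `ι` is linearly ordered
and `η^S` is the product of the `η_k`, `k ∈ S`, in increasing order.  The series is stored as the
family of the coefficients of the `η^S`, which are power series in the commuting variables. -/
abbrev SuperSeries (σ ι : Type) [LinearOrder ι] : Type := Finset ι → MvPowerSeries σ ℂ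

namespace SuperSeries

variable {σ σ' ι ι' : Type} [LinearOrder ι] [LinearOrder ι']

/-- The coefficient `P_{α,S}` of `y^α η^S`. -/
def coeff (P : SuperSeries σ ι) (α : σ →₀ ℕ) (S : Finset ι) : ℂ := MvPowerSeries.coeff α (P S)

/-- The partial derivative with respect to a commuting variable. -/
def evenDeriv (i : σ) (P : SuperSeries σ ι) : SuperSeries σ ι :=
  fun S => MvPowerSeries.pderiv ℂ i (P S)

/-- The (left) partial derivative with respect to an anticommuting variable: for `j ∉ S` one has
`η^{S ∪ {j}} = (-1)^{#{k ∈ S, k < j}} η_j η^S`. -/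
def oddDeriv (j : ι) (P : SuperSeries σ ι) : SuperSeries σ ι :=
  fun S => if j ∈ S then 0 else ((-1 : ℂ) ^ (S.filter (· < j)).card) • P (insert j S)

/-- The product with a commuting variable (which is central). -/
def mulVar (i : σ) (P : SuperSeries σ ι) : SuperSeries σ ι :=
  fun S => MvPowerSeries.X i * P S

/-- Substitution of variables for variables, order preserving on the anticommuting ones. -/
def rename [Finite σ] [Fintype ι] (f : σ → σ') (g : ι ↪o ι') (P : SuperSeries σ ι) :
    SuperSeries σ' ι' :=
  fun T => ∑ S : Finset ι, if S.map g.toEmbedding = T then MvPowerSeries.rename f (P S) else 0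

/-- `P` is even: only monomials with an even number of anticommuting factors occur. -/
def IsEven (P : SuperSeries σ ι) : Prop := ∀ α S, P.coeff α S ≠ 0 → Even S.card

/-- `P` is odd: only monomials with an odd number of anticommuting factors occur. -/
def IsOdd (P : SuperSeries σ ι) : Prop := ∀ α S, P.coeff α S ≠ 0 → Odd S.card

/-- `P` is real, i.e. invariant under the conjugation which is antilinear, fixes all variables, and
reverses products, `conj (a b) = conj b * conj a`; reversing `η^S` gives the sign
`(-1)^{n (n-1) / 2}`, where `n` is the number of elements of `S`. -/
def IsReal (P : SuperSeries σ ι) : Prop :=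
  ∀ α S, (starRingEnd ℂ) (P.coeff α S) * (-1 : ℂ) ^ (S.card.choose 2) = P.coeff α S

/-- `P` is entire: for every `R > 0` there is a `C > 0` with `|P_{α,S}| ≤ C R^{-|α|}`. -/
def IsEntire (P : SuperSeries σ ι) : Prop :=
  ∀ R : ℝ, 0 < R → ∃ C : ℝ, 0 < C ∧ ∀ α S, ‖P.coeff α S‖ ≤ C * (R ^ α.degree)⁻¹

/-- `P` has lower degree at least `n`: all its terms of total degree less than `n` vanish. -/
def LowerDegreeGE (n : ℕ) (P : SuperSeries σ ι) : Prop :=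
  ∀ α S, P.coeff α S ≠ 0 → n ≤ α.degree + S.card

end SuperSeries

/-! ### Evolution systems with constant coefficient linear part -/

/-- Spatial jet variables `∂^ν Ξ_k` (`ν` a multiindex in `d` space variables, `k : X`), ordered
lexicographically. -/
abbrev Jet (d : ℕ) (X : Type) : Type := Lex (Lex (Fin d → ℕ) × X)

namespace Jet

variable {d : ℕ} {X : Type}

/-- The jet variable `∂^ν Ξ_k`. -/
def mk (ν : Fin d → ℕ) (k : X) : Jet d X := toLex (toLex ν, k)

/-- The order `|ν|` of the derivative in the jet variable `∂^ν Ξ_k`. -/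
def order (v : Jet d X) : ℕ := ∑ a, ofLex (ofLex v).1 a

/-- The index `k` of the jet variable `∂^ν Ξ_k`. -/
def index (v : Jet d X) : X := (ofLex v).2

/-- The inclusion of the field variables themselves into the jet variables. -/
def zeroJet (d : ℕ) (X : Type) [LinearOrder X] : X ↪o Jet d X where
  toFun k := mk 0 k
  inj' k l h := congrArg index h
  map_rel_iff' := by
    intro k l
    simp only [Function.Embedding.coeFn_mk, mk, Prod.Lex.toLex_le_toLex, true_and]
    exact or_iff_right (lt_irrefl _)

end Jet

/-- A system of evolution equations on `ℝ × ℝ^d`,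
`∂_t Ξ_i = ∑_j K_{ij}(∂_x) Ξ_j + Δ_i[Ξ]`,
for commuting components `Ξ_b` (`b : B`) and anticommuting components `Ξ_f` (`f : F`), where the
`K_{ij}` are real polynomials in `∂_1, …, ∂_d` and the `Δ_i` are differential power series, i.e.
power series in the jet variables `∂^ν Ξ_j`. -/
structure EvolutionSystem (d : ℕ) (B F : Type) [LinearOrder F] where
  /-- the linear part `K(∂_x)` -/
  lin : Matrix (B ⊕ F) (B ⊕ F) (MvPolynomial (Fin d) ℝ)
  /-- the interaction `Δ` -/
  int : B ⊕ F → SuperSeries (Jet d B) (Jet d F)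

/-- The constant `(2π)^{-d/2}`. -/
def fourierConst (d : ℕ) : ℂ := (((2 * Real.pi) ^ (-(d : ℝ) / 2) : ℝ) : ℂ)

namespace EvolutionSystem

variable {d : ℕ} {B F : Type} [Fintype B] [DecidableEq B] [Fintype F] [LinearOrder F]

/-- The symbol `K(ip)` of the linear part. -/
def symbol (E : EvolutionSystem d B F) (p : EuclideanSpace ℝ (Fin d)) :
    Matrix (B ⊕ F) (B ⊕ F) ℂ :=
  E.lin.map fun q => MvPolynomial.aeval (fun a => Complex.I * (p a : ℂ)) q

/-- The spatially Fourier transformed influence function `Â(t,p)`, i.e. the solution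
`(2π)^{-d/2} exp(t K(ip))` of `∂_t Â = K(ip) Â`, `Â(0,p) = (2π)^{-d/2} 1`. -/
def influence (E : EvolutionSystem d B F) (t : ℝ) (p : EuclideanSpace ℝ (Fin d)) :
    Matrix (B ⊕ F) (B ⊕ F) ℂ :=
  fourierConst d • NormedSpace.exp ((t : ℂ) • E.symbol p)

/-- The class of evolution systems under consideration, with smoothness offsets `τ` (the free
evolution and the interaction are to operate on the spaces of Cauchy data whose component `i` lies in
the Sobolev space `H_{k + τ i}(ℝ^d)`): the linear part preserves the parity of the components; the
interaction terms are real, entire, of lower degree at least two and of the parity of the component;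
the term `Δ_i` involves `∂^ν Ξ_j` only if `|ν| ≤ τ_j - τ_i`; and, locally uniformly in time, the
entries of the Fourier transformed influence function satisfy
`|Â_{ij}(t,p)| ≤ C (1 + |p|)^{τ_j - τ_i}`. -/
structure IsAdmissible (E : EvolutionSystem d B F) (τ : B ⊕ F → ℤ) : Prop where
  lin_even_odd : ∀ b f, E.lin (Sum.inl b) (Sum.inr f) = 0
  lin_odd_even : ∀ b f, E.lin (Sum.inr f) (Sum.inl b) = 0
  int_even : ∀ b, (E.int (Sum.inl b)).IsEven
  int_odd : ∀ f, (E.int (Sum.inr f)).IsOdd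
  int_real : ∀ i, (E.int i).IsReal
  int_entire : ∀ i, (E.int i).IsEntire
  int_lowerDegree : ∀ i, (E.int i).LowerDegreeGE 2
  int_order_even : ∀ i α S, (E.int i).coeff α S ≠ 0 →
    ∀ v ∈ α.support, (v.order : ℤ) ≤ τ (Sum.inl v.index) - τ i
  int_order_odd : ∀ i α S, (E.int i).coeff α S ≠ 0 →
    ∀ v ∈ S, (v.order : ℤ) ≤ τ (Sum.inr v.index) - τ i
  influence_bound : ∀ T : ℝ, 0 < T → ∃ C : ℝ, 0 < C ∧ ∀ t : ℝ, |t| ≤ T → ∀ p i j,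
    ‖E.influence t p i j‖ ≤ C * (1 + ‖p‖) ^ (τ j - τ i)

/-- The tempered distribution `u` is the inverse spatial Fourier transform
`u(x) = (2π)^{-d/2} ∫ g(p) exp(i p x) dp` of the function `g`, in the sense of distributions. -/
def IsInverseFourier (g : EuclideanSpace ℝ (Fin d) → ℂ)
    (u : 𝓢'(EuclideanSpace ℝ (Fin d), ℂ)) : Prop :=
  ∀ φ : 𝓢(EuclideanSpace ℝ (Fin d), ℂ),
    MeasureTheory.Integrable (fun p => g p *
      ∫ x, Complex.exp (Complex.I * (inner ℝ p x : ℝ)) * φ x) ∧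
    u φ = fourierConst d * ∫ p, g p * ∫ x, Complex.exp (Complex.I * (inner ℝ p x : ℝ)) * φ x

/-- The system is causal: the influence function `A`, i.e. the inverse spatial Fourier transform of
`Â`, is supported in the light cone `{(t,x) : |x| ≤ |t|}`.  As `Â(t,p)` is smooth in `t`, `A` is given
by the distributions `A(t,·)` on the time slices, and the condition is stated slice by slice. -/
def IsCausal (E : EvolutionSystem d B F) : Prop :=
  ∀ (t : ℝ) (i j : B ⊕ F), ∃ u : 𝓢'(EuclideanSpace ℝ (Fin d), ℂ),
    IsInverseFourier (fun p => E.influence t p i j) u ∧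
    Distribution.dsupport u ⊆ {x | ‖x‖ ≤ |t|}

end EvolutionSystem

/-! ### The field models -/

/-- A first-order differential operator `∑_μ a^μ ∂_μ + b` on `ℝ^{1+d}` with constant complex matrix
coefficients; the index `0` is time. -/
structure FirstOrderOp (d n : ℕ) where
  /-- the coefficient of `∂_μ` -/
  coeff : Fin (d + 1) → Matrix (Fin n) (Fin n) ℂ
  /-- the zeroth order term -/
  const : Matrix (Fin n) (Fin n) ℂ

namespace FirstOrderOp

variable {d n : ℕ}

/-- The operator as a matrix of polynomials in the commuting symbols `∂_0, …, ∂_d`. -/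
def poly (L : FirstOrderOp d n) : Matrix (Fin n) (Fin n) (MvPolynomial (Fin (d + 1)) ℂ) :=
  ∑ μ, (MvPolynomial.X μ : MvPolynomial (Fin (d + 1)) ℂ) • (L.coeff μ).map MvPolynomial.C
    + L.const.map MvPolynomial.C

/-- The matrix `L(0, ip)`. -/
def spatial (L : FirstOrderOp d n) (p : EuclideanSpace ℝ (Fin d)) : Matrix (Fin n) (Fin n) ℂ :=
  ∑ a : Fin d, (Complex.I * (p a : ℂ)) • L.coeff a.succ + L.const

end FirstOrderOp

/-- The symbol `-∂_0² + ∂_1² + ⋯ + ∂_d²` of the Klein-Gordon operator `□`. -/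
def boxPoly (d : ℕ) : MvPolynomial (Fin (d + 1)) ℂ :=
  -MvPolynomial.X 0 ^ 2 + ∑ a : Fin d, MvPolynomial.X a.succ ^ 2

/-- A real matrix as a complex one. -/
def Matrix.toComplex {m n : Type*} (A : Matrix m n ℝ) : Matrix m n ℂ := A.map Complex.ofReal

/-- The massive Dirac operator `i (-∑_μ Γ^μ ∂_μ + m)`. -/
def diracOp {d n : ℕ} (Γ : Fin (d + 1) → Matrix (Fin n) (Fin n) ℝ) (m : Matrix (Fin n) (Fin n) ℝ) :
    FirstOrderOp d n where
  coeff μ := -(Complex.I • (Γ μ).toComplex)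
  const := Complex.I • m.toComplex

/-- `K L = □ + M` as differential operators. -/
def IsKleinGordonFactor {d n : ℕ} (L K : FirstOrderOp d n) (M : Matrix (Fin n) (Fin n) ℝ) : Prop :=
  K.poly * L.poly = boxPoly d • 1 + M.toComplex.map MvPolynomial.C

/-- A classical field model on `ℝ^{1+d}` with real commuting second-order fields `Φ_i`,
`i < nB`, and real anticommuting first-order fields `Ψ_k`, `k < nF`, with Lagrange density
`(1/2) (-∂_μ Φ_i ∂^μ Φ_i - m^Φ_{ij} Φ_i Φ_j + i ∂_μ Ψ_k Γ^μ_{kl} Ψ_l + i Ψ_k m^Ψ_{kl} Ψ_l)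
  + V'(Ξ) + V^{μ,i}(Ξ) ∂_μ Φ_i`, where `Ξ = (Φ|Ψ)`. -/
structure FieldModel (d nB nF : ℕ) where
  /-- `m^Φ` -/
  massB : Matrix (Fin nB) (Fin nB) ℝ
  massB_symm : massBᵀ = massB
  /-- `Γ^μ` -/
  Γ : Fin (d + 1) → Matrix (Fin nF) (Fin nF) ℝ
  Γ_symm : ∀ μ, (Γ μ)ᵀ = Γ μ
  /-- `m^Ψ` -/
  massF : Matrix (Fin nF) (Fin nF) ℝ
  massF_antisymm : massFᵀ = -massF
  exists_kleinGordonFactor : ∃ K M, IsKleinGordonFactor (diracOp Γ massF) K M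
  /-- `V'` -/
  pot : SuperSeries (Fin nB) (Fin nF)
  pot_real : pot.IsReal
  pot_even : pot.IsEven
  pot_entire : pot.IsEntire
  pot_lowerDegree : pot.LowerDegreeGE 3
  /-- `V^{μ,i}` -/
  derivPot : Fin (d + 1) → Fin nB → SuperSeries (Fin nB) (Fin nF)
  derivPot_real : ∀ μ i, (derivPot μ i).IsReal
  derivPot_even : ∀ μ i, (derivPot μ i).IsEven
  derivPot_entire : ∀ μ i, (derivPot μ i).IsEntire
  derivPot_lowerDegree : ∀ μ i, (derivPot μ i).LowerDegreeGE 2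

namespace FieldModel

variable {d nB nF : ℕ}

/-- The commuting components of the first-order system: the fields `Φ_i` (`Sum.inl i`) and the
velocities `Φ̇_i` (`Sum.inr i`). -/
abbrev Bos (nB : ℕ) : Type := Fin nB ⊕ Fin nB

/-- All components `(Φ_i, Φ̇_i | Ψ_k)` of the first-order system. -/
abbrev Comp (nB nF : ℕ) : Type := Bos nB ⊕ Fin nF

/-- `V^{μ,ij} = ∂V^{μ,j}/∂Φ_i - ∂V^{μ,i}/∂Φ_j`. -/
def curvPot (𝓜 : FieldModel d nB nF) (μ : Fin (d + 1)) (i j : Fin nB) :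
    SuperSeries (Fin nB) (Fin nF) :=
  (𝓜.derivPot μ j).evenDeriv i - (𝓜.derivPot μ i).evenDeriv j

/-- A power series in `Ξ = (Φ|Ψ)` as a series in the jets of `(Φ, Φ̇ | Ψ)`. -/
def lift (P : SuperSeries (Fin nB) (Fin nF)) :
    SuperSeries (Jet d (Bos nB)) (Jet d (Fin nF)) :=
  P.rename (fun i => Jet.mk 0 (Sum.inl i)) (Jet.zeroJet d (Fin nF))

/-- The jet variable which stands for `∂_μ Φ_i` in the first-order system: `Φ̇_i` for `μ = 0`, and
the first spatial derivative of `Φ_i` otherwise. -/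
def dΦ (μ : Fin (d + 1)) (i : Fin nB) : Jet d (Bos nB) :=
  Fin.cases (Jet.mk 0 (Sum.inr i)) (fun a => Jet.mk (Pi.single a 1) (Sum.inl i)) μ

/-- The interaction term `∂V'/∂Φ_i + V^{μ,ij} ∂_μ Φ_j` in the equation for `Φ̇_i`. -/
def forceΦ (𝓜 : FieldModel d nB nF) (i : Fin nB) :
    SuperSeries (Jet d (Bos nB)) (Jet d (Fin nF)) :=
  lift (𝓜.pot.evenDeriv i) + ∑ μ, ∑ j, (lift (𝓜.curvPot μ i j)).mulVar (dΦ μ j)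

/-- `∂V/∂Ψ_k = ∂V'/∂Ψ_k + (∂V^{μ,i}/∂Ψ_k) ∂_μ Φ_i`. -/
def forceΨ (𝓜 : FieldModel d nB nF) (k : Fin nF) :
    SuperSeries (Jet d (Bos nB)) (Jet d (Fin nF)) :=
  lift (𝓜.pot.oddDeriv k) + ∑ μ, ∑ i, (lift ((𝓜.derivPot μ i).oddDeriv k)).mulVar (dΦ μ i)

/-- The first-order evolution system of the model:
`∂_t Φ_i = Φ̇_i`,
`∂_t Φ̇_i = Δ Φ_i - m^Φ_{ij} Φ_j + ∂V'/∂Φ_i + V^{μ,ij} ∂_μ Φ_j`,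
`∂_t Ψ_i = -((Γ^0)⁻¹)_{ij} (Γ^a_{jk} ∂_a Ψ_k - m^Ψ_{jk} Ψ_k + i ∂V/∂Ψ_j)`. -/
def firstOrderSystem (𝓜 : FieldModel d nB nF) : EvolutionSystem d (Bos nB) (Fin nF) where
  lin := Matrix.fromBlocks
    (Matrix.fromBlocks 0 1
      ((∑ a : Fin d, (MvPolynomial.X a : MvPolynomial (Fin d) ℝ) ^ 2) • 1
        - 𝓜.massB.map MvPolynomial.C) 0)
    0 0
    (-((𝓜.Γ 0)⁻¹.map MvPolynomial.C *
      (∑ a : Fin d, (MvPolynomial.X a : MvPolynomial (Fin d) ℝ) • (𝓜.Γ a.succ).map MvPolynomial.C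
        - 𝓜.massF.map MvPolynomial.C)))
  int := Sum.elim (Sum.elim (fun _ => 0) 𝓜.forceΦ)
    fun k => -∑ l, (Complex.I * (((𝓜.Γ 0)⁻¹ k l : ℝ) : ℂ)) • 𝓜.forceΨ l

/-- The smoothness offsets: `1` for the `Φ_i`, and `0` for the velocities `Φ̇_i` and the `Ψ_k`. -/
def offsets (nB nF : ℕ) : Comp nB nF → ℤ :=
  Sum.elim (Sum.elim (fun _ => 1) fun _ => 0) fun _ => 0

/-- The Fourier transformed influence function `Â^Ψ(t,p)` of the fermionic sector. -/
def influenceΨ (𝓜 : FieldModel d nB nF) (t : ℝ) (p : EuclideanSpace ℝ (Fin d)) :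
    Matrix (Fin nF) (Fin nF) ℂ :=
  (𝓜.firstOrderSystem.influence t p).toBlocks₂₂

end FieldModel

/-! ### Explicit influence functions -/

/-- `cos (t √A)`, as the power series `∑ (-1)^k t^{2k} A^k / (2k)!`. -/
def cosSqrt {n : ℕ} (t : ℝ) (A : Matrix (Fin n) (Fin n) ℂ) : Matrix (Fin n) (Fin n) ℂ :=
  ∑' k : ℕ, (((-1) ^ k * t ^ (2 * k) / Nat.factorial (2 * k) : ℝ) : ℂ) • A ^ k

/-- `sin (t √A) / √A`, as the power series `∑ (-1)^k t^{2k+1} A^k / (2k+1)!`. -/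
def sinSqrtDiv {n : ℕ} (t : ℝ) (A : Matrix (Fin n) (Fin n) ℂ) : Matrix (Fin n) (Fin n) ℂ :=
  ∑' k : ℕ, (((-1) ^ k * t ^ (2 * k + 1) / Nat.factorial (2 * k + 1) : ℝ) : ℂ) • A ^ k

/-- The `n`-th derivative of a matrix valued function of time (entry by entry). -/
def timeDeriv {m k : Type*} (n : ℕ) (G : ℝ → Matrix m k ℂ) (t : ℝ) : Matrix m k ℂ :=
  Matrix.of fun i j => iteratedDeriv n (fun s => G s i j) t

/-- The matrix `p² + m`. -/
def sqAdd {d n : ℕ} (p : EuclideanSpace ℝ (Fin d)) (m : Matrix (Fin n) (Fin n) ℝ) :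
    Matrix (Fin n) (Fin n) ℂ :=
  ((‖p‖ ^ 2 : ℝ) : ℂ) • 1 + m.toComplex

/-- `L(∂_t, ip)` applied to a matrix valued function of time. -/
def FirstOrderOp.applyTime {d n : ℕ} (L : FirstOrderOp d n) (p : EuclideanSpace ℝ (Fin d))
    (G : ℝ → Matrix (Fin n) (Fin n) ℂ) (t : ℝ) : Matrix (Fin n) (Fin n) ℂ :=
  L.coeff 0 * timeDeriv 1 G t + L.spatial p * G t

/-- The bosonic propagator `(2π)^{-d/2} sin(t √(p² + m^Φ)) / √(p² + m^Φ)`. -/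
def FieldModel.propagatorΦ {d nB nF : ℕ} (𝓜 : FieldModel d nB nF)
    (p : EuclideanSpace ℝ (Fin d)) (t : ℝ) : Matrix (Fin nB) (Fin nB) ℂ :=
  fourierConst d • sinSqrtDiv t (sqAdd p 𝓜.massB)

end

/-! ### Coefficientwise calculus of super power series -/

namespace SuperSeries

variable {σ σ' ι ι' : Type} [LinearOrder ι] [LinearOrder ι']

/-! The conditions on the interaction are read off from monomials. Derivatives, relabelling and
multiplication by a commuting variable change parity, degree and occurring jets in a controlled way
and preserve entireness. The one subtle point is reality: the left derivative by an anticommuting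
variable turns an even real series into an imaginary one, and the factor `i` in front of it repairs
this.

The linear part is studied at complex momenta `w`. Its symbol is block diagonal, with the companion
matrix of `y'' = -A y`, `A = -w² + m^Φ`, and the Dirac generator `S(w)`. Comparing powers of `∂_t`
in `K D = □ + M` gives `S² = w² + M` (`diracGenerator_mul_self`), so `exp(tS)` is the sum of
`cos(t√B)` and `S sin(t√B)/√B` with `B = -w² - M`. Both sectors thus reduce to one second-order
equation. No positivity of `Γ⁰` is needed.

For `w = i(p + iηe)` and `ω² = 1 + |p|² + η²`, the number `-w²` differs from `ω²` by at most `1 +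
2|η|ω`. The energy `ω²|y|² + |y'|²` then grows at most at rate `2|η| + const` (`energy_le`), which
bounds the sine block by `ω⁻¹ e^{|ηt|}` and the cosine block by `e^{|ηt|}`, up to factors bounded
for bounded `t`. In the Dirac block the growth `O(ω)` of `S` cancels the `ω⁻¹`. At `η = 0` this is
the bound with the smoothness offsets, and it contains the final estimates.

For general `η` it says that the influence function has exponential type `|t|` in every imaginary
direction. Causality follows by Paley-Wiener: for a test function supported near `x` with `|x| >
|t|`, the momentum integral is shifted to `p + iηx/|x|` without changing its value, and it tends to
zero as `η → ∞` (`IsExponentialExtension.integral_eq_zero`). -/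

theorem coeff_add (P Q : SuperSeries σ ι) (α : σ →₀ ℕ) (S : Finset ι) :
    (P + Q).coeff α S = P.coeff α S + Q.coeff α S := by
  simp [coeff]

theorem coeff_neg (P : SuperSeries σ ι) (α : σ →₀ ℕ) (S : Finset ι) :
    (-P).coeff α S = -P.coeff α S := by
  simp [coeff]

theorem coeff_smul (c : ℂ) (P : SuperSeries σ ι) (α : σ →₀ ℕ) (S : Finset ι) :
    (c • P).coeff α S = c * P.coeff α S := by
  simp [coeff]

theorem coeff_evenDeriv (i : σ) (P : SuperSeries σ ι) (α : σ →₀ ℕ) (S : Finset ι) :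
    (P.evenDeriv i).coeff α S = P.coeff (α + Finsupp.single i 1) S * (α i + 1) := by
  simp [coeff, evenDeriv, MvPowerSeries.coeff_pderiv]

theorem coeff_oddDeriv (j : ι) (P : SuperSeries σ ι) (α : σ →₀ ℕ) (S : Finset ι) :
    (P.oddDeriv j).coeff α S =
      if j ∈ S then 0 else (-1 : ℂ) ^ (S.filter (· < j)).card * P.coeff α (insert j S) := by
  unfold coeff oddDeriv
  split_ifs <;> simp

theorem coeff_mulVar_add_single (i : σ) (P : SuperSeries σ ι) (α : σ →₀ ℕ) (S : Finset ι) :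
    (P.mulVar i).coeff (α + Finsupp.single i 1) S = P.coeff α S := by
  classical
  simp [coeff, mulVar, MvPowerSeries.X, MvPowerSeries.coeff_monomial_mul]

theorem coeff_mulVar_cases (i : σ) (P : SuperSeries σ ι) (β : σ →₀ ℕ) (S : Finset ι) :
    (P.mulVar i).coeff β S = 0 ∨ ∃ α, β = α + Finsupp.single i 1 := by
  classical
  by_cases h : Finsupp.single i 1 ≤ β
  · exact Or.inr ⟨β - Finsupp.single i 1, (tsub_add_cancel_of_le h).symm⟩
  · left
    simp [coeff, mulVar, MvPowerSeries.X, MvPowerSeries.coeff_monomial_mul, h]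

/-- Renaming along injective maps only relabels coefficients and fills in zeros, so any property
stated coefficient by coefficient transfers. -/
theorem coeff_rename_cases [Finite σ] [Fintype ι] (f : σ → σ') (hf : Function.Injective f)
    (g : ι ↪o ι') (P : SuperSeries σ ι) (β : σ' →₀ ℕ) (T : Finset ι') :
    (P.rename f g).coeff β T = 0 ∨ ∃ α S, β = α.mapDomain f ∧ T = S.map g.toEmbedding ∧
      (P.rename f g).coeff β T = P.coeff α S := by
  by_cases hT : ∃ S : Finset ι, T = S.map g.toEmbedding
  · obtain ⟨S, rfl⟩ := hT
    have key : P.rename f g (S.map g.toEmbedding) = MvPowerSeries.rename f (P S) := by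
      unfold SuperSeries.rename
      rw [Finset.sum_eq_single S] <;> simp +contextual
    by_cases hβ : β ∈ Set.range (Finsupp.mapDomain f)
    · obtain ⟨α, rfl⟩ := hβ
      refine Or.inr ⟨α, S, rfl, rfl, ?_⟩
      have := MvPowerSeries.coeff_embDomain_rename (⟨f, hf⟩ : σ ↪ σ') (P S) α
      rw [Finsupp.embDomain_eq_mapDomain] at this
      simpa [coeff, key] using this
    · left
      rw [coeff, key, MvPowerSeries.coeff_rename_eq_zero _ _ hβ]
  · left
    have key : P.rename f g T = 0 := by
      unfold SuperSeries.rename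
      refine Finset.sum_eq_zero fun S _ => if_neg fun h => hT ⟨S, h.symm⟩
    simp [coeff, key]

/-- All monomials which occur in `P` satisfy `p`. -/
def SupportedOn (p : (σ →₀ ℕ) → Finset ι → Prop) (P : SuperSeries σ ι) : Prop :=
  ∀ α S, P.coeff α S ≠ 0 → p α S

namespace SupportedOn

variable {p q : (σ →₀ ℕ) → Finset ι → Prop} {P Q : SuperSeries σ ι}

theorem zero : SupportedOn p (0 : SuperSeries σ ι) := fun α S h => absurd (by simp [coeff]) h

theorem add (hP : SupportedOn p P) (hQ : SupportedOn p Q) : SupportedOn p (P + Q) := by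
  intro α S h
  by_cases h0 : P.coeff α S = 0
  · exact hQ α S fun h1 => h (by rw [coeff_add, h0, h1, add_zero])
  · exact hP α S h0

theorem smul (c : ℂ) (hP : SupportedOn p P) : SupportedOn p (c • P) := fun α S h =>
  hP α S fun h0 => h (by rw [coeff_smul, h0, mul_zero])

theorem neg (hP : SupportedOn p P) : SupportedOn p (-P) := fun α S h =>
  hP α S fun h0 => h (by rw [coeff_neg, h0, neg_zero])

theorem sub (hP : SupportedOn p P) (hQ : SupportedOn p Q) : SupportedOn p (P - Q) := by
  rw [sub_eq_add_neg]
  exact hP.add hQ.neg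

theorem sum {κ : Type*} (s : Finset κ) {R : κ → SuperSeries σ ι}
    (h : ∀ k ∈ s, SupportedOn p (R k)) : SupportedOn p (∑ k ∈ s, R k) :=
  Finset.sum_induction _ _ (fun _ _ => add) zero h

theorem mono (hP : SupportedOn p P) (h : ∀ α S, p α S → q α S) : SupportedOn q P :=
  fun α S hS => h α S (hP α S hS)

theorem evenDeriv (hP : SupportedOn p P) (i : σ)
    (h : ∀ α S, p (α + Finsupp.single i 1) S → q α S) : SupportedOn q (P.evenDeriv i) :=
  fun α S hS => h α S <| hP _ S fun h0 => hS (by rw [coeff_evenDeriv, h0, zero_mul])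

theorem oddDeriv (hP : SupportedOn p P) (j : ι)
    (h : ∀ α S, j ∉ S → p α (insert j S) → q α S) : SupportedOn q (P.oddDeriv j) := by
  intro α S hS
  rw [coeff_oddDeriv] at hS
  split_ifs at hS with hj
  · exact absurd rfl hS
  · exact h α S hj (hP _ _ (right_ne_zero_of_mul hS))

theorem mulVar (hP : SupportedOn p P) (i : σ)
    (h : ∀ α S, p α S → q (α + Finsupp.single i 1) S) : SupportedOn q (P.mulVar i) := by
  intro β S hS
  obtain h0 | ⟨α, rfl⟩ := coeff_mulVar_cases i P β S
  · exact absurd h0 hS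
  · rw [coeff_mulVar_add_single] at hS
    exact h α S (hP α S hS)

theorem rename [Finite σ] [Fintype ι] {q : (σ' →₀ ℕ) → Finset ι' → Prop} (hP : SupportedOn p P)
    {f : σ → σ'} (hf : Function.Injective f) (g : ι ↪o ι')
    (h : ∀ α S, p α S → q (α.mapDomain f) (S.map g.toEmbedding)) :
    SupportedOn q (P.rename f g) := by
  intro β T hS
  obtain h0 | ⟨α, S, rfl, rfl, h0⟩ := coeff_rename_cases f hf g P β T
  · exact absurd h0 hS
  · rw [h0] at hS
    exact h α S (hP α S hS)

end SupportedOn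

namespace IsEntire

variable {P Q : SuperSeries σ ι}

theorem zero : (0 : SuperSeries σ ι).IsEntire := fun R hR =>
  ⟨1, one_pos, fun α S => by simpa [coeff] using by positivity⟩

theorem add (hP : P.IsEntire) (hQ : Q.IsEntire) : (P + Q).IsEntire := by
  intro R hR
  obtain ⟨C, hC, h⟩ := hP R hR
  obtain ⟨C', hC', h'⟩ := hQ R hR
  refine ⟨C + C', by positivity, fun α S => ?_⟩
  rw [coeff_add, add_mul]
  exact (norm_add_le _ _).trans (add_le_add (h α S) (h' α S))

theorem smul (c : ℂ) (hP : P.IsEntire) : (c • P).IsEntire := by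
  intro R hR
  obtain ⟨C, hC, h⟩ := hP R hR
  refine ⟨(‖c‖ + 1) * C, by positivity, fun α S => ?_⟩
  rw [coeff_smul, norm_mul, mul_assoc]
  have := h α S
  gcongr
  linarith

theorem neg (hP : P.IsEntire) : (-P).IsEntire := by
  simpa using hP.smul (-1)

theorem sub (hP : P.IsEntire) (hQ : Q.IsEntire) : (P - Q).IsEntire := by
  rw [sub_eq_add_neg]
  exact hP.add hQ.neg

theorem sum {κ : Type*} (s : Finset κ) {R : κ → SuperSeries σ ι}
    (h : ∀ k ∈ s, (R k).IsEntire) : (∑ k ∈ s, R k).IsEntire :=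
  Finset.sum_induction _ _ (fun _ _ => add) zero h

theorem evenDeriv (hP : P.IsEntire) (i : σ) : (P.evenDeriv i).IsEntire := by
  intro R hR
  -- Doubling the radius yields a factor `2^{-(|α|+1)}`, which absorbs the factor `α_i + 1` produced
  -- by differentiation.
  obtain ⟨C, hC, h⟩ := hP (2 * R) (by positivity)
  refine ⟨C * R⁻¹, by positivity, fun α S => ?_⟩
  have h1 := h (α + Finsupp.single i 1) S
  have hdeg : (α + Finsupp.single i 1).degree = α.degree + 1 := by
    rw [map_add, Finsupp.degree_single]
  have h2 : ((α i : ℝ) + 1) ≤ 2 ^ (α.degree + 1) := by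
    have : α i ≤ α.degree := Finsupp.le_degree i α
    have h3 : α.degree + 1 < 2 ^ (α.degree + 1) := Nat.lt_two_pow_self
    exact_mod_cast (by omega : α i + 1 ≤ 2 ^ (α.degree + 1))
  rw [coeff_evenDeriv, norm_mul]
  have h4 : ‖((α i : ℂ) + 1)‖ = (α i : ℝ) + 1 := by
    rw [← Nat.cast_add_one, Complex.norm_natCast, Nat.cast_add_one]
  rw [h4]
  rw [hdeg] at h1
  calc _ ≤ C * ((2 * R) ^ (α.degree + 1))⁻¹ * 2 ^ (α.degree + 1) := by gcongr
    _ = _ := by rw [mul_pow]; field_simp; ring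

theorem oddDeriv (hP : P.IsEntire) (j : ι) : (P.oddDeriv j).IsEntire := by
  intro R hR
  obtain ⟨C, hC, h⟩ := hP R hR
  refine ⟨C, hC, fun α S => ?_⟩
  rw [coeff_oddDeriv]
  split_ifs
  · simpa using by positivity
  · simpa using h α (insert j S)

theorem mulVar (hP : P.IsEntire) (i : σ) : (P.mulVar i).IsEntire := by
  intro R hR
  obtain ⟨C, hC, h⟩ := hP R hR
  refine ⟨C * R, by positivity, fun β S => ?_⟩
  obtain h0 | ⟨α, rfl⟩ := coeff_mulVar_cases i P β S
  · rw [h0]; simpa using by positivity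
  · rw [coeff_mulVar_add_single, map_add, Finsupp.degree_single]
    refine (h α S).trans (le_of_eq ?_)
    field_simp
    ring

theorem rename [Finite σ] [Fintype ι] (hP : P.IsEntire) {f : σ → σ'}
    (hf : Function.Injective f) (g : ι ↪o ι') : (P.rename f g).IsEntire := by
  intro R hR
  obtain ⟨C, hC, h⟩ := hP R hR
  refine ⟨C, hC, fun β T => ?_⟩
  obtain h0 | ⟨α, S, rfl, rfl, h0⟩ := coeff_rename_cases f hf g P β T
  · rw [h0]; simpa using by positivity
  · rw [h0, Finsupp.degree_mapDomain]
    exact h α S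

end IsEntire

/-- `P` is multiplied by `ε` under the conjugation. -/
def ConjEq (ε : ℂ) (P : SuperSeries σ ι) : Prop :=
  ∀ α S, (starRingEnd ℂ) (P.coeff α S) * (-1 : ℂ) ^ (S.card.choose 2) = ε * P.coeff α S

theorem isReal_iff_conjEq_one {P : SuperSeries σ ι} : P.IsReal ↔ ConjEq 1 P := by
  simp [IsReal, ConjEq]

namespace ConjEq

variable {ε : ℂ} {P Q : SuperSeries σ ι}

theorem zero : ConjEq ε (0 : SuperSeries σ ι) := fun α S => by simp [coeff]

theorem add (hP : ConjEq ε P) (hQ : ConjEq ε Q) : ConjEq ε (P + Q) := fun α S => by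
  rw [coeff_add, map_add, add_mul, hP, hQ, mul_add]

theorem smul {c δ : ℂ} (hc : (starRingEnd ℂ) c = δ * c) (hP : ConjEq ε P) :
    ConjEq (δ * ε) (c • P) := fun α S => by
  rw [coeff_smul, map_mul, mul_assoc, hP, hc]; ring

theorem neg (hP : ConjEq ε P) : ConjEq ε (-P) := by
  simpa using hP.smul (c := -1) (δ := 1) (by simp)

theorem sub (hP : ConjEq ε P) (hQ : ConjEq ε Q) : ConjEq ε (P - Q) := by
  rw [sub_eq_add_neg]
  exact hP.add hQ.neg

theorem sum {κ : Type*} (s : Finset κ) {R : κ → SuperSeries σ ι}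
    (h : ∀ k ∈ s, ConjEq ε (R k)) : ConjEq ε (∑ k ∈ s, R k) :=
  Finset.sum_induction _ _ (fun _ _ => add) zero h

theorem evenDeriv (hP : ConjEq ε P) (i : σ) : ConjEq ε (P.evenDeriv i) := fun α S => by
  have := hP (α + Finsupp.single i 1) S
  rw [coeff_evenDeriv, map_mul, ← mul_assoc, ← this]
  simp
  ring

/-- Removing one factor from a monomial with an even number `#S + 1` of them changes the reversal
exponent `n(n-1)/2` by `#S`, which is odd; hence the sign flips. -/
theorem oddDeriv (hP : ConjEq ε P) (he : P.IsEven) (j : ι) : ConjEq (-ε) (P.oddDeriv j) := by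
  intro α S
  rw [coeff_oddDeriv]
  split_ifs with hj
  · simp
  by_cases h0 : P.coeff α (insert j S) = 0
  · simp [h0]
  have h1 := hP α (insert j S)
  have h2 := he _ _ h0
  rw [Finset.card_insert_of_notMem hj] at h1 h2
  have h3 : (S.card + 1).choose 2 = S.card + S.card.choose 2 := by
    rw [Nat.choose_succ_succ' S.card 1, Nat.choose_one_right]
  have h4 : (-1 : ℂ) ^ S.card = -1 := Odd.neg_one_pow (by grind)
  rw [h3, pow_add, h4] at h1
  simp only [map_mul, map_pow, map_neg, map_one]
  linear_combination (-(-1 : ℂ) ^ (S.filter (· < j)).card) * h1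

theorem mulVar (hP : ConjEq ε P) (i : σ) : ConjEq ε (P.mulVar i) := by
  intro β S
  obtain h0 | ⟨α, rfl⟩ := coeff_mulVar_cases i P β S
  · simp [h0]
  · rw [coeff_mulVar_add_single]
    exact hP α S

theorem rename [Finite σ] [Fintype ι] (hP : ConjEq ε P) {f : σ → σ'}
    (hf : Function.Injective f) (g : ι ↪o ι') : ConjEq ε (P.rename f g) := by
  intro β T
  obtain h0 | ⟨α, S, rfl, rfl, h0⟩ := coeff_rename_cases f hf g P β T
  · simp [h0]
  · rw [h0, Finset.card_map]
    exact hP α S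

end ConjEq

end SuperSeries

/-! ### The interaction terms of the model -/

namespace Jet

variable {d : ℕ} {X : Type}

theorem order_mk (ν : Fin d → ℕ) (k : X) : (mk ν k).order = ∑ a, ν a := rfl

theorem index_mk (ν : Fin d → ℕ) (k : X) : (mk ν k).index = k := rfl

end Jet

namespace FieldModel

open SuperSeries

variable {d nB nF : ℕ}

theorem injective_mk_zero_inl :
    Function.Injective fun i : Fin nB => (Jet.mk 0 (Sum.inl i) : Jet d (Bos nB)) :=
  fun _ _ h => Sum.inl_injective (congrArg Jet.index h)

/-- The jet variables which may occur in the interaction terms. -/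
def IsLowJet (v : Jet d (Bos nB)) : Prop :=
  (v.order : ℤ) ≤ offsets nB 0 (Sum.inl v.index)

theorem isLowJet_mk_zero (i : Fin nB) : IsLowJet (Jet.mk 0 (Sum.inl i) : Jet d (Bos nB)) := by
  simp [IsLowJet, Jet.order_mk, Jet.index_mk, offsets]

/-- Spatial derivatives of first order fall only on the `Φ_i`, whose offset is 1, while the
velocities occur undifferentiated. This suffices because every component with a nonzero interaction
has offset 0. -/
theorem isLowJet_dΦ (μ : Fin (d + 1)) (i : Fin nB) : IsLowJet (dΦ μ i) := by
  cases μ using Fin.cases <;> simp [dΦ, IsLowJet, Jet.order_mk, Jet.index_mk, offsets]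

/-- The monomials of total degree at least `n` which contain only low jets. -/
def LowMonomial (par : ℕ → Prop) (n : ℕ) (α : Jet d (Bos nB) →₀ ℕ)
    (S : Finset (Jet d (Fin nF))) : Prop :=
  par S.card ∧ n ≤ α.degree + S.card ∧ (∀ v ∈ α.support, IsLowJet v) ∧ ∀ v ∈ S, v.order = 0

theorem supportedOn_lift {par : ℕ → Prop} {n : ℕ} {P : SuperSeries (Fin nB) (Fin nF)}
    (hP : SupportedOn (fun α S => par S.card ∧ n ≤ α.degree + S.card) P) :
    SupportedOn (LowMonomial par n) (lift P : SuperSeries (Jet d (Bos nB)) (Jet d (Fin nF))) := by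
  refine hP.rename injective_mk_zero_inl _ fun α S h => ⟨?_, ?_, ?_, ?_⟩
  · rw [Finset.card_map]; exact h.1
  · rw [Finset.card_map, Finsupp.degree_mapDomain]; exact h.2
  · intro v hv
    classical
    obtain ⟨i, -, rfl⟩ := Finset.mem_image.1 (Finsupp.mapDomain_support hv)
    exact isLowJet_mk_zero i
  · intro v hv
    obtain ⟨k, -, rfl⟩ := Finset.mem_map.1 hv
    exact (Jet.order_mk 0 k).trans (by simp)

theorem supportedOn_mulVar_dΦ {par : ℕ → Prop} {n : ℕ}
    {P : SuperSeries (Jet d (Bos nB)) (Jet d (Fin nF))}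
    (hP : SupportedOn (LowMonomial par n) P) (μ : Fin (d + 1)) (i : Fin nB) :
    SupportedOn (LowMonomial par (n + 1)) (P.mulVar (dΦ μ i)) := by
  refine hP.mulVar _ fun α S h => ⟨h.1, ?_, ?_, h.2.2.2⟩
  · rw [map_add, Finsupp.degree_single]
    have := h.2.1
    omega
  · intro v hv
    classical
    rcases Finset.mem_union.1 (Finsupp.support_add hv) with hv | hv
    · exact h.2.2.1 v hv
    · rw [Finset.mem_singleton.1 (Finsupp.support_single_subset hv)]
      exact isLowJet_dΦ μ i

variable (𝓜 : FieldModel d nB nF)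

theorem supportedOn_pot :
    SupportedOn (fun α S => Even S.card ∧ 3 ≤ α.degree + S.card) 𝓜.pot :=
  fun α S h => ⟨𝓜.pot_even α S h, 𝓜.pot_lowerDegree α S h⟩

theorem supportedOn_derivPot (μ : Fin (d + 1)) (i : Fin nB) :
    SupportedOn (fun α S => Even S.card ∧ 2 ≤ α.degree + S.card) (𝓜.derivPot μ i) :=
  fun α S h => ⟨𝓜.derivPot_even μ i α S h, 𝓜.derivPot_lowerDegree μ i α S h⟩

theorem supportedOn_evenDeriv {n : ℕ} {P : SuperSeries (Fin nB) (Fin nF)}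
    (hP : SupportedOn (fun α S => Even S.card ∧ n + 1 ≤ α.degree + S.card) P) (i : Fin nB) :
    SupportedOn (fun α S => Even S.card ∧ n ≤ α.degree + S.card) (P.evenDeriv i) :=
  hP.evenDeriv i fun α S h => by
    rw [map_add, Finsupp.degree_single] at h
    exact ⟨h.1, by omega⟩

theorem supportedOn_oddDeriv {n : ℕ} {P : SuperSeries (Fin nB) (Fin nF)}
    (hP : SupportedOn (fun α S => Even S.card ∧ n + 1 ≤ α.degree + S.card) P) (k : Fin nF) :
    SupportedOn (fun α S => Odd S.card ∧ n ≤ α.degree + S.card) (P.oddDeriv k) :=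
  hP.oddDeriv k fun α S hk h => by
    rw [Finset.card_insert_of_notMem hk] at h
    exact ⟨by grind, by omega⟩

theorem supportedOn_forceΦ (i : Fin nB) : SupportedOn (LowMonomial Even 2) (𝓜.forceΦ i) :=
  (supportedOn_lift (supportedOn_evenDeriv 𝓜.supportedOn_pot i)).add <|
    SupportedOn.sum _ fun μ _ => SupportedOn.sum _ fun j _ => supportedOn_mulVar_dΦ
      (supportedOn_lift ((supportedOn_evenDeriv (𝓜.supportedOn_derivPot μ j) i).sub
        (supportedOn_evenDeriv (𝓜.supportedOn_derivPot μ i) j))) μ j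

theorem supportedOn_forceΨ (k : Fin nF) : SupportedOn (LowMonomial Odd 2) (𝓜.forceΨ k) :=
  (supportedOn_lift (supportedOn_oddDeriv 𝓜.supportedOn_pot k)).add <|
    SupportedOn.sum _ fun μ _ => SupportedOn.sum _ fun i _ => supportedOn_mulVar_dΦ
      (supportedOn_lift (supportedOn_oddDeriv (𝓜.supportedOn_derivPot μ i) k)) μ i

theorem isEntire_forceΦ (i : Fin nB) : (𝓜.forceΦ i).IsEntire :=
  ((𝓜.pot_entire.evenDeriv i).rename injective_mk_zero_inl _).add <|
    IsEntire.sum _ fun μ _ => IsEntire.sum _ fun j _ => IsEntire.mulVar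
      ((((𝓜.derivPot_entire μ j).evenDeriv i).sub
        ((𝓜.derivPot_entire μ i).evenDeriv j)).rename injective_mk_zero_inl _) _

theorem isEntire_forceΨ (k : Fin nF) : (𝓜.forceΨ k).IsEntire :=
  ((𝓜.pot_entire.oddDeriv k).rename injective_mk_zero_inl _).add <|
    IsEntire.sum _ fun μ _ => IsEntire.sum _ fun i _ => IsEntire.mulVar
      (((𝓜.derivPot_entire μ i).oddDeriv k).rename injective_mk_zero_inl _) _

theorem conjEq_forceΦ (i : Fin nB) : ConjEq 1 (𝓜.forceΦ i) :=
  have h := fun μ j => isReal_iff_conjEq_one.1 (𝓜.derivPot_real μ j)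
  (((isReal_iff_conjEq_one.1 𝓜.pot_real).evenDeriv i).rename injective_mk_zero_inl _).add <|
    ConjEq.sum _ fun μ _ => ConjEq.sum _ fun j _ => ConjEq.mulVar
      ((((h μ j).evenDeriv i).sub ((h μ i).evenDeriv j)).rename injective_mk_zero_inl _) _

theorem conjEq_forceΨ (k : Fin nF) : ConjEq (-1) (𝓜.forceΨ k) :=
  (((isReal_iff_conjEq_one.1 𝓜.pot_real).oddDeriv 𝓜.pot_even k).rename
    injective_mk_zero_inl _).add <|
    ConjEq.sum _ fun μ _ => ConjEq.sum _ fun i _ => ConjEq.mulVar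
      (((isReal_iff_conjEq_one.1 (𝓜.derivPot_real μ i)).oddDeriv
        (𝓜.derivPot_even μ i) k).rename injective_mk_zero_inl _) _

theorem supportedOn_int_inr (k : Fin nF) :
    SupportedOn (LowMonomial Odd 2) (𝓜.firstOrderSystem.int (Sum.inr k)) :=
  (SupportedOn.sum _ fun l _ => (𝓜.supportedOn_forceΨ l).smul _).neg

theorem supportedOn_int_inl (b : Bos nB) :
    SupportedOn (LowMonomial Even 2) (𝓜.firstOrderSystem.int (Sum.inl b)) := by
  rcases b with i | i
  · exact SupportedOn.zero
  · exact 𝓜.supportedOn_forceΦ i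

theorem isEntire_int (i : Comp nB nF) : (𝓜.firstOrderSystem.int i).IsEntire := by
  rcases i with (i | i) | k
  · exact IsEntire.zero
  · exact 𝓜.isEntire_forceΦ i
  · exact (IsEntire.sum _ fun l _ => (𝓜.isEntire_forceΨ l).smul _).neg

theorem isReal_int (i : Comp nB nF) : (𝓜.firstOrderSystem.int i).IsReal := by
  rw [isReal_iff_conjEq_one]
  rcases i with (i | i) | k
  · exact ConjEq.zero
  · exact 𝓜.conjEq_forceΦ i
  · refine (ConjEq.sum _ fun l _ => ?_).neg
    -- The imaginary coefficient contributes a second sign `-1`, which cancels that of the odd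
    -- derivative.
    simpa using (𝓜.conjEq_forceΨ l).smul (δ := -1) (c := Complex.I * (((𝓜.Γ 0)⁻¹ k l : ℝ) : ℂ))
      (by simp)

theorem lowerDegreeGE_int (i : Comp nB nF) : (𝓜.firstOrderSystem.int i).LowerDegreeGE 2 := by
  rcases i with b | k
  · exact (𝓜.supportedOn_int_inl b).mono fun _ _ h => h.2.1
  · exact (𝓜.supportedOn_int_inr k).mono fun _ _ h => h.2.1

theorem int_order_even (i : Comp nB nF) (α : Jet d (Bos nB) →₀ ℕ) (S : Finset (Jet d (Fin nF)))
    (h : (𝓜.firstOrderSystem.int i).coeff α S ≠ 0) (v : Jet d (Bos nB)) (hv : v ∈ α.support) :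
    (v.order : ℤ) ≤ offsets nB nF (Sum.inl v.index) - offsets nB nF i := by
  rcases i with (i | i) | k
  -- The equation for `Φ_i`, the only component of offset 1, has no interaction term.
  · exact absurd (by simp [firstOrderSystem, coeff]) h
  · simpa [offsets, IsLowJet] using (𝓜.supportedOn_int_inl _ α S h).2.2.1 v hv
  · simpa [offsets, IsLowJet] using (𝓜.supportedOn_int_inr _ α S h).2.2.1 v hv

theorem int_order_odd (i : Comp nB nF) (α : Jet d (Bos nB) →₀ ℕ) (S : Finset (Jet d (Fin nF)))
    (h : (𝓜.firstOrderSystem.int i).coeff α S ≠ 0) (v : Jet d (Fin nF)) (hv : v ∈ S) :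
    (v.order : ℤ) ≤ offsets nB nF (Sum.inr v.index) - offsets nB nF i := by
  rcases i with (i | i) | k
  · exact absurd (by simp [firstOrderSystem, coeff]) h
  · simp [offsets, (𝓜.supportedOn_int_inl _ α S h).2.2.2 v hv]
  · simp [offsets, (𝓜.supportedOn_int_inr _ α S h).2.2.2 v hv]

end FieldModel

/-! ### Matrix exponentials, cosine and sine series -/

namespace Matrix

open scoped Matrix.Norms.Operator

theorem hasSum_iff_apply {ι m n : Type*} {f : ι → Matrix m n ℂ} {A : Matrix m n ℂ} :
    HasSum f A ↔ ∀ i j, HasSum (fun k => f k i j) (A i j) :=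
  Pi.hasSum.trans (forall_congr' fun _ => Pi.hasSum)

section Exp

variable {m n : Type*} [Fintype m] [DecidableEq m] [Fintype n] [DecidableEq n]

theorem hasSum_exp_smul (t : ℝ) (X : Matrix n n ℂ) :
    HasSum (fun k : ℕ => ((t ^ k / Nat.factorial k : ℝ) : ℂ) • X ^ k)
      (NormedSpace.exp ((t : ℂ) • X)) := by
  have h := NormedSpace.exp_series_hasSum_exp' (𝕂 := ℂ) ((t : ℂ) • X)
  have h1 : (fun k : ℕ => ((t ^ k / Nat.factorial k : ℝ) : ℂ) • X ^ k) =
      fun k : ℕ => ((Nat.factorial k : ℂ)⁻¹) • ((t : ℂ) • X) ^ k := by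
    funext k
    rw [smul_pow, smul_smul]
    congr 1
    push_cast
    ring
  rw [h1]
  exact h

theorem hasDerivAt_exp_smul_apply (t : ℝ) (X : Matrix n n ℂ) (i j : n) :
    HasDerivAt (fun s : ℝ => NormedSpace.exp ((s : ℂ) • X) i j)
      ((X * NormedSpace.exp ((t : ℂ) • X)) i j) t := by
  have h := hasDerivAt_exp_smul_const' (𝕂 := ℂ) X (t : ℂ)
  exact (hasDerivAt_pi.1 (hasDerivAt_pi.1 h i) j).comp_ofReal

theorem exp_smul_fromBlocks_diagonal (t : ℝ) (X : Matrix m m ℂ) (Y : Matrix n n ℂ) :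
    NormedSpace.exp ((t : ℂ) • fromBlocks X 0 0 Y) =
      fromBlocks (NormedSpace.exp ((t : ℂ) • X)) 0 0 (NormedSpace.exp ((t : ℂ) • Y)) := by
  have h := hasSum_exp_smul t (fromBlocks X 0 0 Y)
  have hX := hasSum_iff_apply.1 (hasSum_exp_smul t X)
  have hY := hasSum_iff_apply.1 (hasSum_exp_smul t Y)
  simp only [fromBlocks_diagonal_pow, fromBlocks_smul _ (_ ^ _), smul_zero] at h
  refine h.unique (hasSum_iff_apply.2 ?_)
  rintro (i | i) (j | j)
  · exact hX i j
  · exact hasSum_zero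
  · exact hasSum_zero
  · exact hY i j

theorem differentiable_exp_apply {X : ℂ → Matrix n n ℂ}
    (hX : ∀ i j, Differentiable ℂ fun z => X z i j) (i j : n) :
    Differentiable ℂ fun z => NormedSpace.exp (X z) i j := by
  have h1 : Differentiable ℂ X := differentiable_pi.2 fun i => differentiable_pi.2 (hX i)
  have h2 : Differentiable ℂ (NormedSpace.exp : Matrix n n ℂ → Matrix n n ℂ) := fun x =>
    (NormedSpace.exp_analytic (𝕂 := ℂ) x).differentiableAt
  exact differentiable_pi.1 (differentiable_pi.1 (h2.comp h1) i) j

theorem continuous_exp_apply {V : Type*} [TopologicalSpace V] {X : V → Matrix n n ℂ}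
    (hX : Continuous X) (i j : n) : Continuous fun z => NormedSpace.exp (X z) i j :=
  (NormedSpace.exp_continuous.comp hX).matrix_elem i j

end Exp

variable {n : ℕ}

/-- The matrix of the first-order system equivalent to `y'' = -A y`. -/
def companion (A : Matrix (Fin n) (Fin n) ℂ) : Matrix (Fin n ⊕ Fin n) (Fin n ⊕ Fin n) ℂ :=
  fromBlocks 0 1 (-A) 0

theorem companion_pow_even (A : Matrix (Fin n) (Fin n) ℂ) (k : ℕ) :
    companion A ^ (2 * k) = fromBlocks ((-A) ^ k) 0 0 ((-A) ^ k) := by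
  rw [pow_mul, pow_two, companion, fromBlocks_multiply]
  simp [fromBlocks_diagonal_pow]

theorem companion_pow_odd (A : Matrix (Fin n) (Fin n) ℂ) (k : ℕ) :
    companion A ^ (2 * k + 1) = fromBlocks 0 ((-A) ^ k) ((-A) ^ (k + 1)) 0 := by
  rw [pow_succ, companion_pow_even, companion, fromBlocks_multiply]
  simp [pow_succ]

theorem neg_pow_eq_smul (A : Matrix (Fin n) (Fin n) ℂ) (k : ℕ) :
    (-A) ^ k = ((-1 : ℂ) ^ k) • A ^ k := by
  rw [← smul_pow, neg_one_smul]

theorem neg_one_pow_mul_self (k : ℕ) : (-1 : ℂ) ^ k * (-1 : ℂ) ^ k = 1 := by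
  rw [← mul_pow]; simp

/-- Even powers of the companion matrix are diagonal and odd ones off-diagonal, so the cosine series
is a block of the exponential series. Its convergence comes for free. -/
theorem hasSum_cosSqrt_companion (t : ℝ) (A : Matrix (Fin n) (Fin n) ℂ) :
    HasSum (fun k : ℕ => (((-1) ^ k * t ^ (2 * k) / Nat.factorial (2 * k) : ℝ) : ℂ) • A ^ k)
      (NormedSpace.exp ((t : ℂ) • companion A)).toBlocks₁₁ := by
  refine hasSum_iff_apply.2 fun i j => ?_
  have h := hasSum_iff_apply.1 (hasSum_exp_smul t (companion A)) (Sum.inl i) (Sum.inl j)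
  have hinj : Function.Injective fun k : ℕ => 2 * k := fun a b h => by simpa using h
  have h' := (hinj.hasSum_iff (fun k hk => ?_)).2 h
  · convert h' using 2 with k
    simp only [Function.comp_apply, companion_pow_even, neg_pow_eq_smul, smul_apply,
      fromBlocks_apply₁₁, smul_eq_mul]
    · push_cast
      ring
    · rfl
  · obtain ⟨l, rfl | rfl⟩ := Nat.even_or_odd' k
    · exact absurd ⟨l, rfl⟩ hk
    · simp [companion_pow_odd]

theorem hasSum_sinSqrtDiv_companion (t : ℝ) (A : Matrix (Fin n) (Fin n) ℂ) :
    HasSum (fun k : ℕ =>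
      (((-1) ^ k * t ^ (2 * k + 1) / Nat.factorial (2 * k + 1) : ℝ) : ℂ) • A ^ k)
      (NormedSpace.exp ((t : ℂ) • companion A)).toBlocks₁₂ := by
  refine hasSum_iff_apply.2 fun i j => ?_
  have h := hasSum_iff_apply.1 (hasSum_exp_smul t (companion A)) (Sum.inl i) (Sum.inr j)
  have hinj : Function.Injective fun k : ℕ => 2 * k + 1 := fun a b h => by simpa using h
  have h' := (hinj.hasSum_iff (fun k hk => ?_)).2 h
  · convert h' using 2 with k
    simp only [Function.comp_apply, companion_pow_odd, neg_pow_eq_smul, smul_apply,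
      fromBlocks_apply₁₂, smul_eq_mul]
    · push_cast
      ring
    · rfl
  · obtain ⟨l, rfl | rfl⟩ := Nat.even_or_odd' k
    · simp [companion_pow_even]
    · exact absurd ⟨l, rfl⟩ hk

theorem hasSum_cosSqrt (t : ℝ) (A : Matrix (Fin n) (Fin n) ℂ) :
    HasSum (fun k : ℕ => (((-1) ^ k * t ^ (2 * k) / Nat.factorial (2 * k) : ℝ) : ℂ) • A ^ k)
      (cosSqrt t A) :=
  (hasSum_cosSqrt_companion t A).summable.hasSum

theorem hasSum_sinSqrtDiv (t : ℝ) (A : Matrix (Fin n) (Fin n) ℂ) :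
    HasSum (fun k : ℕ =>
      (((-1) ^ k * t ^ (2 * k + 1) / Nat.factorial (2 * k + 1) : ℝ) : ℂ) • A ^ k)
      (sinSqrtDiv t A) :=
  (hasSum_sinSqrtDiv_companion t A).summable.hasSum

/-- `exp (t S) = cos (t √(-S²)) + S sin (t √(-S²)) / √(-S²)`. -/
theorem exp_smul_eq_cosSqrt_add (t : ℝ) (S : Matrix (Fin n) (Fin n) ℂ) :
    NormedSpace.exp ((t : ℂ) • S) =
      cosSqrt t (-(S * S)) + S * sinSqrtDiv t (-(S * S)) := by
  refine (hasSum_exp_smul t S).unique (HasSum.even_add_odd ?_ ?_)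
  · convert hasSum_cosSqrt t (-(S * S)) using 2 with k
    rw [neg_pow_eq_smul, smul_smul, pow_mul S, pow_two S]
    congr 1
    push_cast
    linear_combination (-(t : ℂ) ^ (2 * k) / (Nat.factorial (2 * k) : ℂ)) * neg_one_pow_mul_self k
  · refine ((hasSum_sinSqrtDiv t (-(S * S))).mul_left S).congr_fun fun k => ?_
    rw [neg_pow_eq_smul, smul_smul, mul_smul_comm, pow_succ' S, pow_mul S, pow_two S]
    congr 1
    push_cast
    linear_combination (-(t : ℂ) ^ (2 * k + 1) / (Nat.factorial (2 * k + 1) : ℂ)) *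
      neg_one_pow_mul_self k

/-- The upper row is known from the series. Since the exponential commutes with the companion
matrix, the upper row determines the lower one. -/
theorem exp_smul_companion (t : ℝ) (A : Matrix (Fin n) (Fin n) ℂ) :
    NormedSpace.exp ((t : ℂ) • companion A) =
      fromBlocks (cosSqrt t A) (sinSqrtDiv t A) (-(A * sinSqrtDiv t A)) (cosSqrt t A) := by
  set E := NormedSpace.exp ((t : ℂ) • companion A) with hE
  have h11 : E.toBlocks₁₁ = cosSqrt t A :=
    (hasSum_cosSqrt_companion t A).unique (hasSum_cosSqrt t A)
  have h12 : E.toBlocks₁₂ = sinSqrtDiv t A :=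
    (hasSum_sinSqrtDiv_companion t A).unique (hasSum_sinSqrtDiv t A)
  have hcomm : companion A * E = E * companion A :=
    (((Commute.refl (companion A)).smul_right (t : ℂ)).exp_right).eq
  have hcommA : A * sinSqrtDiv t A = sinSqrtDiv t A * A :=
    ((hasSum_sinSqrtDiv t A).mul_left A).unique <| by
      simpa only [mul_smul_comm, smul_mul_assoc, (Commute.self_pow A _).eq] using
        (hasSum_sinSqrtDiv t A).mul_right A
  rw [← fromBlocks_toBlocks E, h11, h12, companion, fromBlocks_multiply, fromBlocks_multiply,
    fromBlocks_inj] at hcomm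
  simp only [zero_mul, one_mul, zero_add, mul_zero, mul_one, add_zero, mul_neg] at hcomm
  rw [← fromBlocks_toBlocks E, h11, h12, hcomm.1, hcomm.2.1, hcommA]

/-- Read off from the derivative of the exponential of the companion matrix; no series is
differentiated term by term. -/
theorem hasDerivAt_sinSqrtDiv_apply (t : ℝ) (A : Matrix (Fin n) (Fin n) ℂ) (i j : Fin n) :
    HasDerivAt (fun s => sinSqrtDiv s A i j) (cosSqrt t A i j) t := by
  have h := hasDerivAt_exp_smul_apply t (companion A) (Sum.inl i) (Sum.inr j)
  simp only [exp_smul_companion] at h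
  simpa [companion, fromBlocks_multiply] using h

theorem hasDerivAt_cosSqrt_apply (t : ℝ) (A : Matrix (Fin n) (Fin n) ℂ) (i j : Fin n) :
    HasDerivAt (fun s => cosSqrt s A i j) (-(A * sinSqrtDiv t A) i j) t := by
  have h := hasDerivAt_exp_smul_apply t (companion A) (Sum.inl i) (Sum.inl j)
  simp only [exp_smul_companion] at h
  simpa [companion, fromBlocks_multiply] using h

theorem sinSqrtDiv_zero (A : Matrix (Fin n) (Fin n) ℂ) : sinSqrtDiv 0 A = 0 := by
  simp [sinSqrtDiv]

theorem cosSqrt_zero (A : Matrix (Fin n) (Fin n) ℂ) : cosSqrt 0 A = 1 := by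
  have h := congrArg toBlocks₁₁ (exp_smul_companion 0 A)
  simpa [← fromBlocks_one] using h.symm

/-- An intertwining relation passes to all powers and hence to the series. It is used for `P` the
time coefficient of the Dirac operator and for `P` its generator. -/
theorem cosSqrt_conj (t : ℝ) {A B P : Matrix (Fin n) (Fin n) ℂ} (h : A * P = P * B) :
    cosSqrt t A * P = P * cosSqrt t B := by
  refine ((hasSum_cosSqrt t A).mul_right P).unique ?_
  convert (hasSum_cosSqrt t B).mul_left P using 2 with k
  rw [smul_mul_assoc, mul_smul_comm]
  congr 1
  exact ((show SemiconjBy P B A from h.symm).pow_right k).eq.symm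

end Matrix

/-! ### Algebra of the factorization `K D = □ + M` -/

namespace Matrix

variable {m n l : Type*}

theorem toComplex_mul [Fintype m] (A : Matrix l m ℝ) (B : Matrix m n ℝ) :
    (A * B).toComplex = A.toComplex * B.toComplex :=
  Matrix.map_mul (f := Complex.ofRealHom)

theorem toComplex_one [DecidableEq n] : (1 : Matrix n n ℝ).toComplex = 1 :=
  Matrix.map_one _ Complex.ofReal_zero Complex.ofReal_one

theorem toComplex_neg (A : Matrix m n ℝ) : (-A).toComplex = -A.toComplex := by
  ext; simp [toComplex]

end Matrix

namespace FirstOrderOp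

variable {d n : ℕ}

/-- The matrix `L(0, w)` for complex `w`. -/
def spatialAt (L : FirstOrderOp d n) (w : Fin d → ℂ) : Matrix (Fin n) (Fin n) ℂ :=
  ∑ a : Fin d, w a • L.coeff a.succ + L.const

theorem spatial_eq_spatialAt (L : FirstOrderOp d n) (p : EuclideanSpace ℝ (Fin d)) :
    L.spatial p = L.spatialAt fun a => Complex.I * (p a : ℂ) := rfl

theorem map_eval_poly (L : FirstOrderOp d n) (c : ℂ) (w : Fin d → ℂ) :
    (MvPolynomial.eval (Fin.cons c w : Fin (d + 1) → ℂ)).mapMatrix L.poly =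
      c • L.coeff 0 + L.spatialAt w := by
  ext i j
  simp [poly, spatialAt, Matrix.sum_apply, Fin.sum_univ_succ, add_assoc]

end FirstOrderOp

namespace IsKleinGordonFactor

variable {d n : ℕ} {L K : FirstOrderOp d n} {M : Matrix (Fin n) (Fin n) ℝ}

/-- The factorization is an identity of polynomials in commuting symbols, so it may be evaluated at
complex numbers. -/
theorem mul_eq (h : IsKleinGordonFactor L K M) (c : ℂ) (w : Fin d → ℂ) :
    (c • K.coeff 0 + K.spatialAt w) * (c • L.coeff 0 + L.spatialAt w) =
      (-c ^ 2 + ∑ a, w a ^ 2) • 1 + M.toComplex := by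
  have h1 := congrArg (MvPolynomial.eval (Fin.cons c w : Fin (d + 1) → ℂ)).mapMatrix h
  rw [map_mul, FirstOrderOp.map_eval_poly, FirstOrderOp.map_eval_poly] at h1
  rw [h1]
  ext i j
  by_cases hij : i = j <;> simp [boxPoly, hij]

theorem spatialAt_mul (h : IsKleinGordonFactor L K M) (w : Fin d → ℂ) :
    K.spatialAt w * L.spatialAt w = (∑ a, w a ^ 2) • 1 + M.toComplex := by
  simpa using h.mul_eq 0 w

/-- These are the coefficients of `c²` and `c` in the identity `mul_eq`, extracted from its values
at `c = 0, 1, -1`. -/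
theorem coeff_mul_and (h : IsKleinGordonFactor L K M) (w : Fin d → ℂ) :
    K.coeff 0 * L.coeff 0 = -1 ∧ K.coeff 0 * L.spatialAt w + K.spatialAt w * L.coeff 0 = 0 := by
  have h0 := h.spatialAt_mul w
  have h1 := h.mul_eq 1 w
  have h2 := h.mul_eq (-1) w
  simp only [add_mul, mul_add, smul_mul_assoc, mul_smul_comm, add_smul, h0] at h1 h2
  constructor
  · linear_combination (norm := module) (1 / 2 : ℂ) • h1 + (1 / 2 : ℂ) • h2
  · linear_combination (norm := module) (1 / 2 : ℂ) • h1 - (1 / 2 : ℂ) • h2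

theorem coeff_zero_mul (h : IsKleinGordonFactor L K M) : K.coeff 0 * L.coeff 0 = -1 :=
  (h.coeff_mul_and 0).1

theorem coeff_zero_mul_spatialAt (h : IsKleinGordonFactor L K M) (w : Fin d → ℂ) :
    K.coeff 0 * L.spatialAt w + K.spatialAt w * L.coeff 0 = 0 :=
  (h.coeff_mul_and w).2

end IsKleinGordonFactor

section Dirac

variable {d n : ℕ} (Γ : Fin (d + 1) → Matrix (Fin n) (Fin n) ℝ) (m : Matrix (Fin n) (Fin n) ℝ)

/-- The generator `-(Γ⁰)⁻¹ (Γᵃ w_a - m)` of the time evolution of the Dirac operator. -/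
noncomputable def diracGenerator (w : Fin d → ℂ) : Matrix (Fin n) (Fin n) ℂ :=
  -((Γ 0)⁻¹.toComplex * (∑ a : Fin d, w a • (Γ a.succ).toComplex - m.toComplex))

variable {Γ m} {K : FirstOrderOp d n} {M : Matrix (Fin n) (Fin n) ℝ}

/-- The time coefficient of the Dirac operator is `-iΓ⁰`, and the time coefficient of `-K` is a left
inverse of it. -/
theorem isUnit_det_of_isKleinGordonFactor (h : IsKleinGordonFactor (diracOp Γ m) K M) :
    IsUnit (Γ 0).det := by
  have h1 := congrArg Matrix.det h.coeff_zero_mul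
  have h2 : ((Γ 0).toComplex).det = ((Γ 0).det : ℂ) := (RingHom.map_det Complex.ofRealHom _).symm
  rw [isUnit_iff_ne_zero]
  intro h0
  have h3 : (diracOp Γ m).coeff 0 = (-Complex.I) • (Γ 0).toComplex := by simp [diracOp]
  rw [Matrix.det_mul, h3, Matrix.det_smul, h2, h0, Complex.ofReal_zero, mul_zero, mul_zero] at h1
  have h4 : IsUnit (-1 : Matrix (Fin n) (Fin n) ℂ) := isUnit_one.neg
  rw [Matrix.isUnit_iff_isUnit_det, ← h1] at h4
  exact not_isUnit_zero h4

/-- In other words `D = D₀ (∂_t - S)`, with `D₀` the time coefficient: `S` is the Dirac equation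
solved for the time derivative. -/
theorem diracOp_spatialAt (h : IsKleinGordonFactor (diracOp Γ m) K M) (w : Fin d → ℂ) :
    (diracOp Γ m).spatialAt w = -((diracOp Γ m).coeff 0 * diracGenerator Γ m w) := by
  have h1 : (Γ 0).toComplex * (Γ 0)⁻¹.toComplex = 1 := by
    rw [← Matrix.toComplex_mul, Matrix.mul_nonsing_inv _ (isUnit_det_of_isKleinGordonFactor h),
      Matrix.toComplex_one]
  simp only [diracOp, diracGenerator, FirstOrderOp.spatialAt, neg_mul, mul_neg, neg_neg,
    smul_mul_assoc, ← mul_assoc, h1, one_mul, smul_sub, Finset.smul_sum, smul_neg,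
    Finset.sum_neg_distrib, smul_comm Complex.I]
  abel

theorem spatialAt_mul_diracOp_coeff_zero (h : IsKleinGordonFactor (diracOp Γ m) K M)
    (w : Fin d → ℂ) : K.spatialAt w * (diracOp Γ m).coeff 0 = -diracGenerator Γ m w := by
  have h1 := h.coeff_zero_mul_spatialAt w
  rw [diracOp_spatialAt h, mul_neg, ← mul_assoc, h.coeff_zero_mul, neg_one_mul, neg_neg] at h1
  exact eq_neg_of_add_eq_zero_right h1

/-- From `D(0,w) = -D₀ S` and `K(0,w) D₀ = -S` one gets `S² = K(0,w) D(0,w)`. This reduces the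
fermions to a Klein-Gordon equation. -/
theorem diracGenerator_mul_self (h : IsKleinGordonFactor (diracOp Γ m) K M) (w : Fin d → ℂ) :
    diracGenerator Γ m w * diracGenerator Γ m w = (∑ a, w a ^ 2) • 1 + M.toComplex := by
  rw [← h.spatialAt_mul w, diracOp_spatialAt h, mul_neg, ← mul_assoc,
    spatialAt_mul_diracOp_coeff_zero h, neg_mul, neg_neg]

/-- At `w = 0` the square formula reads `M = ((Γ⁰)⁻¹ m)²`, so `Γ⁰ M = m (Γ⁰)⁻¹ m`, which is
symmetric because `Γ⁰` is symmetric and `m` antisymmetric. Thus `D₀` intertwines `M` and `Mᵀ`. -/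
theorem mass_transpose_mul_diracOp_coeff_zero (h : IsKleinGordonFactor (diracOp Γ m) K M)
    (hΓ : (Γ 0)ᵀ = Γ 0) (hm : mᵀ = -m) :
    (Mᵀ).toComplex * (diracOp Γ m).coeff 0 = (diracOp Γ m).coeff 0 * M.toComplex := by
  have hu := isUnit_det_of_isKleinGordonFactor h
  have h1 : Γ 0 * M = m * (Γ 0)⁻¹ * m := by
    have h2 := diracGenerator_mul_self h 0
    simp only [diracGenerator, Pi.zero_apply, zero_smul, Finset.sum_const_zero, zero_sub, mul_neg,
      neg_neg, ne_eq, OfNat.ofNat_ne_zero, not_false_eq_true, zero_pow, zero_add,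
      ← Matrix.toComplex_mul] at h2
    have h3 : (Γ 0)⁻¹ * m * ((Γ 0)⁻¹ * m) = M :=
      Matrix.map_injective Complex.ofReal_injective h2
    rw [← h3, mul_assoc (Γ 0)⁻¹, Matrix.mul_nonsing_inv_cancel_left _ _ hu, mul_assoc]
  have h2 : Mᵀ * Γ 0 = Γ 0 * M := by
    have h3 := congrArg Matrix.transpose h1
    rw [Matrix.transpose_mul, hΓ] at h3
    rw [h3, h1, Matrix.transpose_mul, Matrix.transpose_mul, Matrix.transpose_nonsing_inv, hΓ, hm]
    simp [mul_assoc]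
  simp only [diracOp, mul_neg, neg_mul, mul_smul_comm, smul_mul_assoc, ← Matrix.toComplex_mul, h2]

end Dirac

/-! ### Time derivatives and the explicit fermionic influence function -/

namespace Matrix

variable {n : ℕ}

theorem sinSqrtDiv_conj (t : ℝ) {A B P : Matrix (Fin n) (Fin n) ℂ} (h : A * P = P * B) :
    sinSqrtDiv t A * P = P * sinSqrtDiv t B := by
  refine ((hasSum_sinSqrtDiv t A).mul_right P).unique ?_
  convert (hasSum_sinSqrtDiv t B).mul_left P using 2 with k
  rw [smul_mul_assoc, mul_smul_comm]
  congr 1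
  exact ((show SemiconjBy P B A from h.symm).pow_right k).eq.symm

theorem timeDeriv_one_cosSqrt (t : ℝ) (A : Matrix (Fin n) (Fin n) ℂ) :
    timeDeriv 1 (fun s => cosSqrt s A) t = -(A * sinSqrtDiv t A) := by
  ext i j
  simp only [timeDeriv, of_apply, iteratedDeriv_one]
  exact (hasDerivAt_cosSqrt_apply t A i j).deriv

theorem timeDeriv_one_sinSqrtDiv (c : ℂ) (t : ℝ) (A : Matrix (Fin n) (Fin n) ℂ) :
    timeDeriv 1 (fun s => c • sinSqrtDiv s A) t = c • cosSqrt t A := by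
  ext i j
  simp only [timeDeriv, of_apply, iteratedDeriv_one, smul_apply]
  exact ((hasDerivAt_sinSqrtDiv_apply t A i j).const_smul c).deriv

theorem timeDeriv_two_sinSqrtDiv (c : ℂ) (t : ℝ) (A : Matrix (Fin n) (Fin n) ℂ) :
    timeDeriv 2 (fun s => c • sinSqrtDiv s A) t = c • -(A * sinSqrtDiv t A) := by
  ext i j
  have h : deriv (fun s => (c • sinSqrtDiv s A) i j) = fun s => (c • cosSqrt s A) i j :=
    funext fun s => ((hasDerivAt_sinSqrtDiv_apply s A i j).const_smul c).deriv
  simp only [timeDeriv, of_apply, iteratedDeriv_succ, iteratedDeriv_zero, h]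
  exact ((hasDerivAt_cosSqrt_apply t A i j).const_smul c).deriv

end Matrix

/-- Here `M - p² = S²`. On the right, `D(0,ip) = -D₀ S`; moving `D₀` to the left through the
functions of `p² - Mᵀ` turns them into functions of `p² - M = -S²`, and then `D₀` is absorbed by
`K`. Both sides become `(cos + S sin/√) S²`. -/
theorem exp_smul_diracGenerator_mul {d n : ℕ} {Γ : Fin (d + 1) → Matrix (Fin n) (Fin n) ℝ}
    {m : Matrix (Fin n) (Fin n) ℝ} {K : FirstOrderOp d n} {M : Matrix (Fin n) (Fin n) ℝ}
    (h : IsKleinGordonFactor (diracOp Γ m) K M) (hΓ : (Γ 0)ᵀ = Γ 0) (hm : mᵀ = -m)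
    (t : ℝ) (p : EuclideanSpace ℝ (Fin d)) :
    NormedSpace.exp ((t : ℂ) • diracGenerator Γ m fun a => Complex.I * (p a : ℂ)) *
        (-sqAdd p (-M)) =
      K.applyTime p (fun s => cosSqrt s (sqAdd p (-Mᵀ))) t * (diracOp Γ m).spatial p := by
  set S := diracGenerator Γ m fun a => Complex.I * (p a : ℂ) with hS
  set L₀ := (diracOp Γ m).coeff 0 with hL
  have hSS : S * S = -sqAdd p (-M) := by
    rw [hS, diracGenerator_mul_self h, sqAdd, Matrix.toComplex_neg, neg_add, neg_neg]
    congr 1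
    rw [← neg_smul, EuclideanSpace.norm_sq_eq]
    congr 1
    simp [mul_pow]
  have hA : sqAdd p (-Mᵀ) * L₀ = L₀ * sqAdd p (-M) := by
    simp only [sqAdd, add_mul, mul_add, Matrix.toComplex_neg, neg_mul, mul_neg, smul_mul_assoc,
      mul_smul_comm, one_mul, mul_one]
    rw [mass_transpose_mul_diracOp_coeff_zero h hΓ hm]
  rw [FirstOrderOp.applyTime, Matrix.timeDeriv_one_cosSqrt, FirstOrderOp.spatial_eq_spatialAt,
    FirstOrderOp.spatial_eq_spatialAt, diracOp_spatialAt h, ← hS, ← hL, Matrix.exp_smul_eq_cosSqrt_add,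
    ← hSS]
  have hB : -(S * S) = sqAdd p (-M) := by rw [hSS, neg_neg]
  rw [hB]
  have h1 : K.coeff 0 * -(sqAdd p (-Mᵀ) * sinSqrtDiv t (sqAdd p (-Mᵀ))) * L₀ =
      sqAdd p (-M) * sinSqrtDiv t (sqAdd p (-M)) := by
    rw [mul_assoc, neg_mul, mul_assoc, Matrix.sinSqrtDiv_conj t hA, ← mul_assoc (sqAdd p (-Mᵀ)), hA,
      mul_assoc L₀, mul_neg, ← mul_assoc, h.coeff_zero_mul]
    simp
  have h2 : K.spatialAt (fun a => Complex.I * (p a : ℂ)) * cosSqrt t (sqAdd p (-Mᵀ)) * L₀ =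
      -(S * cosSqrt t (sqAdd p (-M))) := by
    rw [mul_assoc, Matrix.cosSqrt_conj t hA, ← mul_assoc, spatialAt_mul_diracOp_coeff_zero h,
      neg_mul]
  have hSA : S * sqAdd p (-M) = sqAdd p (-M) * S := by rw [← hB]; simp [mul_assoc]
  have h3 := Matrix.cosSqrt_conj t hSA.symm
  have h4 := Matrix.sinSqrtDiv_conj t hSA.symm
  rw [mul_neg, ← mul_assoc _ L₀, add_mul (K.coeff 0 * _), h1, h2, ← hB]
  rw [← hB] at h3 h4
  set c := cosSqrt t (-(S * S))
  set s := sinSqrtDiv t (-(S * S))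
  calc (c + S * s) * (S * S) = c * S * S + S * (s * S) * S := by noncomm_ring
    _ = _ := by rw [h3, h4]; noncomm_ring

/-! ### Energy estimate for second-order equations -/

section Energy

variable {W : Type*} [NormedAddCommGroup W] [InnerProductSpace ℝ W]

/-- The derivative of the energy is `2⟨ω² y - f, w⟩ ≤ 2κω|y||w|`, at most `κ` times the energy.
Hence energy times `e^{-κt}` is nonincreasing. -/
theorem energy_le_of_nonneg {y w f : ℝ → W} {ω κ : ℝ}
    (hy : ∀ t, HasDerivAt y (w t) t) (hw : ∀ t, HasDerivAt w (-f t) t)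
    (hf : ∀ t, ‖ω ^ 2 • y t - f t‖ ≤ κ * ω * ‖y t‖) (hκ : 0 ≤ κ) {t : ℝ} (ht : 0 ≤ t) :
    ω ^ 2 * ‖y t‖ ^ 2 + ‖w t‖ ^ 2 ≤ (ω ^ 2 * ‖y 0‖ ^ 2 + ‖w 0‖ ^ 2) * Real.exp (κ * t) := by
  have hE : ∀ s, HasDerivAt (fun s => ω ^ 2 * ‖y s‖ ^ 2 + ‖w s‖ ^ 2)
      (2 * inner ℝ (ω ^ 2 • y s - f s) (w s)) s := by
    intro s
    refine (((hy s).norm_sq.const_mul (ω ^ 2)).add (hw s).norm_sq).congr_deriv ?_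
    rw [inner_neg_right, inner_sub_left, real_inner_smul_left, real_inner_comm (f s)]
    ring
  have hg : ∀ s, HasDerivAt (fun s => (ω ^ 2 * ‖y s‖ ^ 2 + ‖w s‖ ^ 2) * Real.exp (-κ * s))
      ((2 * inner ℝ (ω ^ 2 • y s - f s) (w s) - κ * (ω ^ 2 * ‖y s‖ ^ 2 + ‖w s‖ ^ 2)) *
        Real.exp (-κ * s)) s := by
    intro s
    refine ((hE s).mul ((hasDerivAt_id s).const_mul (-κ)).exp).congr_deriv ?_
    simp only [id]
    ring
  have hanti : Antitone fun s => (ω ^ 2 * ‖y s‖ ^ 2 + ‖w s‖ ^ 2) * Real.exp (-κ * s) := by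
    refine antitone_of_hasDerivAt_nonpos hg fun s => ?_
    refine mul_nonpos_of_nonpos_of_nonneg ?_ (Real.exp_nonneg _)
    have h1 := (real_inner_le_norm (ω ^ 2 • y s - f s) (w s)).trans
      (mul_le_mul_of_nonneg_right (hf s) (norm_nonneg _))
    nlinarith [mul_nonneg hκ (sq_nonneg (ω * ‖y s‖ - ‖w s‖))]
  have h := hanti ht
  simp only [mul_zero, Real.exp_zero, mul_one] at h
  have h2 : Real.exp (-κ * t) * Real.exp (κ * t) = 1 := by
    rw [← Real.exp_add, neg_mul, neg_add_cancel, Real.exp_zero]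
  calc _ = (ω ^ 2 * ‖y t‖ ^ 2 + ‖w t‖ ^ 2) * Real.exp (-κ * t) * Real.exp (κ * t) := by
        rw [mul_assoc, h2, mul_one]
    _ ≤ _ := by gcongr

/-- The energy estimate for `y'' = -f` if `f` differs from `ω² y` by at most `κ ω |y|`. -/
theorem energy_le {y w f : ℝ → W} {ω κ : ℝ}
    (hy : ∀ t, HasDerivAt y (w t) t) (hw : ∀ t, HasDerivAt w (-f t) t)
    (hf : ∀ t, ‖ω ^ 2 • y t - f t‖ ≤ κ * ω * ‖y t‖) (hκ : 0 ≤ κ) (t : ℝ) :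
    ω ^ 2 * ‖y t‖ ^ 2 + ‖w t‖ ^ 2 ≤ (ω ^ 2 * ‖y 0‖ ^ 2 + ‖w 0‖ ^ 2) * Real.exp (κ * |t|) := by
  rcases le_total 0 t with ht | ht
  · rw [abs_of_nonneg ht]
    exact energy_le_of_nonneg hy hw hf hκ ht
  · rw [abs_of_nonpos ht]
    -- Time reversal preserves `y'' = -f` and changes the sign of the velocity.
    have h := energy_le_of_nonneg (y := fun s => y (-s)) (w := fun s => -w (-s))
      (f := fun s => f (-s)) (fun s => ?_) (fun s => ?_) (fun s => hf (-s)) hκ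
      (neg_nonneg.2 ht)
    · simpa using h
    · exact ((hy (-s)).scomp s (hasDerivAt_neg s)).congr_deriv (by simp)
    · exact ((hw (-s)).scomp s (hasDerivAt_neg s)).neg.congr_deriv (by simp)

end Energy

/-! ### Bounds for the cosine and sine matrices -/

namespace Matrix

variable {n : ℕ}

theorem hasDerivAt_toLp {g : ℝ → Fin n → ℂ} {g' : Fin n → ℂ} {t : ℝ}
    (h : ∀ k, HasDerivAt (fun s => g s k) (g' k) t) :
    HasDerivAt (fun s => (WithLp.toLp 2 (g s) : EuclideanSpace ℂ (Fin n))) (WithLp.toLp 2 g') t :=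
  (PiLp.hasFDerivAt_toLp (𝕜 := ℝ) 2 (g t)).comp_hasDerivAt t (hasDerivAt_pi.2 h)

/-- `z` is close to `ω²`, up to terms which amount to growth at the rate `η`. -/
structure IsNearSq (z : ℂ) (ω η : ℝ) : Prop where
  one_le : 1 ≤ ω
  nonneg : 0 ≤ η
  le : η ≤ ω
  norm_sub_le : ‖(ω : ℂ) ^ 2 - z‖ ≤ 1 + 2 * η * ω

/-- Column `j` of the sine matrix solves `y'' = -(z + m) y` with `y(0) = 0` and `y'(0) = e_j`, so
its initial energy is 1. Growth at exactly the rate `η`, with `μ` independent of `z`, is what later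
gives the sharp light cone. -/
theorem norm_sinSqrtDiv_cosSqrt_le (m : Matrix (Fin n) (Fin n) ℂ) :
    ∃ μ : ℝ, 0 ≤ μ ∧ ∀ (z : ℂ) (ω η : ℝ), IsNearSq z ω η → ∀ (t : ℝ) (i j : Fin n),
      ‖sinSqrtDiv t (z • 1 + m) i j‖ ≤ ω⁻¹ * Real.exp (μ * |t|) * Real.exp (η * |t|) ∧
      ‖cosSqrt t (z • 1 + m) i j‖ ≤ Real.exp (μ * |t|) * Real.exp (η * |t|) ∧
      ‖((z • 1 + m) * sinSqrtDiv t (z • 1 + m) : Matrix (Fin n) (Fin n) ℂ) i j‖ ≤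
        (4 + 2 * μ) * ω * Real.exp (μ * |t|) * Real.exp (η * |t|) := by
  set T := toEuclideanCLM (n := Fin n) (𝕜 := ℂ) m with hT
  -- The energy grows at rate `2η + 1 + ‖T‖`; norms grow at half of it, which is `η + μ`.
  refine ⟨(1 + ‖T‖) / 2, by positivity, fun z ω η hz t i j => ?_⟩
  set A := z • 1 + m with hA
  have hω := hz.one_le
  have hω0 : 0 < ω := by linarith
  set y : ℝ → EuclideanSpace ℂ (Fin n) := fun s => WithLp.toLp 2 fun k => sinSqrtDiv s A k j
  set w : ℝ → EuclideanSpace ℂ (Fin n) := fun s => WithLp.toLp 2 fun k => cosSqrt s A k j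
  set f : ℝ → EuclideanSpace ℂ (Fin n) := fun s => z • y s + T (y s) with hf
  have hfA : ∀ s k, f s k = (A * sinSqrtDiv s A) k j := by
    intro s k
    rw [hA, add_mul, smul_mul_assoc, one_mul, ← hA]
    simp [hf, hT, y, Matrix.mulVec, dotProduct, Matrix.mul_apply]
  have hE := energy_le (y := y) (w := w) (f := f) (ω := ω) (κ := 2 * η + 1 + ‖T‖)
    (fun s => ?_) (fun s => ?_) (fun s => ?_) (by have := hz.nonneg; positivity) t
  · have hexp : Real.exp ((2 * η + 1 + ‖T‖) * |t|) =
        (Real.exp ((1 + ‖T‖) / 2 * |t|) * Real.exp (η * |t|)) ^ 2 := by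
      rw [← Real.exp_add, ← Real.exp_nat_mul]
      congr 1
      push_cast
      ring
    have hy0 : y 0 = 0 := by ext k; simp [y, sinSqrtDiv_zero]
    have hw0 : ‖w 0‖ = 1 := by
      have : w 0 = EuclideanSpace.single j 1 := by
        ext k; simp [w, cosSqrt_zero, Matrix.one_apply]
      rw [this]; simp
    rw [hy0, hw0, hexp] at hE
    simp only [norm_zero, ne_eq, OfNat.ofNat_ne_zero, not_false_eq_true, zero_pow, mul_zero,
      one_pow, zero_add, one_mul] at hE
    set ε := Real.exp ((1 + ‖T‖) / 2 * |t|) * Real.exp (η * |t|) with hε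
    have hε0 : 0 < ε := by positivity
    have h1 : ω * ‖y t‖ ≤ ε := by
      refine le_of_sq_le_sq ?_ hε0.le
      nlinarith [sq_nonneg ‖w t‖]
    have h2 : ‖w t‖ ≤ ε := by
      refine le_of_sq_le_sq ?_ hε0.le
      nlinarith [sq_nonneg (ω * ‖y t‖)]
    have h1' : ‖y t‖ ≤ ω⁻¹ * ε := by
      rw [inv_mul_eq_div, le_div_iff₀ hω0]; linarith
    -- Since `1 ≤ ω` and `η ≤ ω`, one has `|z| ≤ ω² + 1 + 2ηω ≤ 4ω²`.
    have hzn : ‖z‖ ≤ 4 * ω ^ 2 := by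
      have h3 := norm_sub_norm_le z ((ω : ℂ) ^ 2)
      rw [norm_sub_rev, norm_pow, Complex.norm_real, Real.norm_eq_abs, sq_abs] at h3
      nlinarith [hz.norm_sub_le, hz.le]
    refine ⟨?_, ?_, ?_⟩
    · rw [mul_assoc]
      exact (PiLp.norm_apply_le (y t) i).trans h1'
    · exact (PiLp.norm_apply_le (w t) i).trans h2
    · rw [← hfA]
      refine (PiLp.norm_apply_le (f t) i).trans ?_
      calc ‖f t‖ ≤ ‖z‖ * ‖y t‖ + ‖T‖ * ‖y t‖ :=
            (norm_add_le _ _).trans (add_le_add (norm_smul_le _ _) (T.le_opNorm _))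
        _ ≤ (4 * ω ^ 2 + ‖T‖) * (ω⁻¹ * ε) := by
            rw [← add_mul]; gcongr
        _ = (4 * ω + ‖T‖ * ω⁻¹) * ε := by field_simp
        _ ≤ ((4 + 2 * ((1 + ‖T‖) / 2)) * ω) * ε := by
            have : ω⁻¹ ≤ ω := (inv_le_one_of_one_le₀ hω).trans hω
            have := mul_le_mul_of_nonneg_left this (norm_nonneg T)
            gcongr
            linarith
        _ = _ := by rw [hε]; ring
  · exact hasDerivAt_toLp fun k => hasDerivAt_sinSqrtDiv_apply s A k j
  · refine (hasDerivAt_toLp fun k => hasDerivAt_cosSqrt_apply s A k j).congr_deriv ?_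
    ext k
    simp [hfA]
  · have h1 : ω ^ 2 • y s - f s = ((ω : ℂ) ^ 2 - z) • y s - T (y s) := by
      rw [sub_smul, hf]
      have : ω ^ 2 • y s = (ω : ℂ) ^ 2 • y s := by
        rw [← Complex.ofReal_pow, Complex.coe_smul]
      rw [this]
      simp only
      abel
    rw [h1]
    calc _ ≤ ‖(ω : ℂ) ^ 2 - z‖ * ‖y s‖ + ‖T‖ * ‖y s‖ :=
          (norm_sub_le _ _).trans (add_le_add (norm_smul_le _ _) (T.le_opNorm _))
      _ ≤ ((1 + 2 * η * ω) + ‖T‖) * ‖y s‖ := by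
          rw [← add_mul]; gcongr; exact hz.norm_sub_le
      _ ≤ _ := by
          gcongr
          nlinarith [norm_nonneg T, mul_nonneg (norm_nonneg T) (sub_nonneg.2 hω)]

end Matrix

/-! ### The symbol of the model at complex momenta and its exponential -/

namespace EvolutionSystem

variable {d : ℕ} {B F : Type} [LinearOrder F]

/-- The symbol `K(w)` of the linear part for complex `w`. -/
noncomputable def symbolAt (E : EvolutionSystem d B F) (w : Fin d → ℂ) :
    Matrix (B ⊕ F) (B ⊕ F) ℂ :=
  E.lin.map fun q => MvPolynomial.aeval w q

theorem continuous_symbolAt_comp {V : Type*} [TopologicalSpace V] (E : EvolutionSystem d B F)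
    {w : V → Fin d → ℂ} (hw : ∀ a, Continuous fun v => w v a) :
    Continuous fun v => E.symbolAt (w v) := by
  refine continuous_matrix fun i j => ?_
  change Continuous fun v => MvPolynomial.aeval (w v) (E.lin i j)
  induction E.lin i j using MvPolynomial.induction_on with
  | C a => simpa using continuous_const
  | add p q hp hq => simp only [map_add]; exact hp.add hq
  | mul_X p a hp => simp only [map_mul, MvPolynomial.aeval_X]; exact hp.mul (hw a)

theorem differentiable_symbolAt_comp (E : EvolutionSystem d B F)
    {w : ℂ → Fin d → ℂ} (hw : ∀ a, Differentiable ℂ fun z => w z a) (i j : B ⊕ F) :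
    Differentiable ℂ fun z => E.symbolAt (w z) i j := by
  change Differentiable ℂ fun z => MvPolynomial.aeval (w z) (E.lin i j)
  induction E.lin i j using MvPolynomial.induction_on with
  | C a => simp
  | add p q hp hq => simp only [map_add]; exact hp.add hq
  | mul_X p a hp => simp only [map_mul, MvPolynomial.aeval_X]; exact hp.mul (hw a)

end EvolutionSystem

namespace FieldModel

variable {d nB nF : ℕ} (𝓜 : FieldModel d nB nF)

theorem symbolAt_firstOrderSystem (w : Fin d → ℂ) :
    𝓜.firstOrderSystem.symbolAt w =
      Matrix.fromBlocks (Matrix.companion ((-∑ a, w a ^ 2) • 1 + 𝓜.massB.toComplex)) 0 0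
        (diracGenerator 𝓜.Γ 𝓜.massF w) := by
  ext (( i | i) | i) ((j | j) | j)
  · simp [EvolutionSystem.symbolAt, firstOrderSystem, Matrix.companion]
  · by_cases h : i = j <;>
      simp [EvolutionSystem.symbolAt, firstOrderSystem, Matrix.companion, h]
  · simp [EvolutionSystem.symbolAt, firstOrderSystem]
  · by_cases h : i = j <;>
      simp [EvolutionSystem.symbolAt, firstOrderSystem, Matrix.companion, Matrix.toComplex, h,
        sub_eq_add_neg]
    · ring
  · simp [EvolutionSystem.symbolAt, firstOrderSystem, Matrix.companion]
  · simp [EvolutionSystem.symbolAt, firstOrderSystem]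
  · simp [EvolutionSystem.symbolAt, firstOrderSystem]
  · simp [EvolutionSystem.symbolAt, firstOrderSystem]
  · simp [EvolutionSystem.symbolAt, firstOrderSystem, diracGenerator, Matrix.mul_apply,
      Matrix.toComplex, Matrix.sum_apply]

theorem exp_smul_symbolAt (t : ℝ) (w : Fin d → ℂ) :
    NormedSpace.exp ((t : ℂ) • 𝓜.firstOrderSystem.symbolAt w) =
      let A := (-∑ a, w a ^ 2) • 1 + 𝓜.massB.toComplex
      Matrix.fromBlocks
        (Matrix.fromBlocks (cosSqrt t A) (sinSqrtDiv t A) (-(A * sinSqrtDiv t A)) (cosSqrt t A))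
        0 0 (NormedSpace.exp ((t : ℂ) • diracGenerator 𝓜.Γ 𝓜.massF w)) := by
  rw [symbolAt_firstOrderSystem, Matrix.exp_smul_fromBlocks_diagonal, Matrix.exp_smul_companion]

theorem influence_eq_exp (t : ℝ) (p : EuclideanSpace ℝ (Fin d)) :
    𝓜.firstOrderSystem.influence t p = fourierConst d •
      NormedSpace.exp ((t : ℂ) • 𝓜.firstOrderSystem.symbolAt fun a => Complex.I * (p a : ℂ)) :=
  rfl

theorem neg_sum_sq_smul_add (p : EuclideanSpace ℝ (Fin d)) :
    (-∑ a, (Complex.I * (p a : ℂ)) ^ 2) • 1 + 𝓜.massB.toComplex = sqAdd p 𝓜.massB := by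
  rw [sqAdd, EuclideanSpace.norm_sq_eq]
  congr 2
  simp [mul_pow]

theorem influence_eq (t : ℝ) (p : EuclideanSpace ℝ (Fin d)) :
    𝓜.firstOrderSystem.influence t p =
      Matrix.fromBlocks
        (Matrix.fromBlocks
          (timeDeriv 1 (𝓜.propagatorΦ p) t) (𝓜.propagatorΦ p t)
          (timeDeriv 2 (𝓜.propagatorΦ p) t) (timeDeriv 1 (𝓜.propagatorΦ p) t))
        0 0 (𝓜.influenceΨ t p) := by
  have h1 : timeDeriv 1 (𝓜.propagatorΦ p) t = fourierConst d • cosSqrt t (sqAdd p 𝓜.massB) :=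
    Matrix.timeDeriv_one_sinSqrtDiv _ _ _
  have h2 : timeDeriv 2 (𝓜.propagatorΦ p) t =
      fourierConst d • -(sqAdd p 𝓜.massB * sinSqrtDiv t (sqAdd p 𝓜.massB)) :=
    Matrix.timeDeriv_two_sinSqrtDiv _ _ _
  rw [h1, h2, propagatorΦ, influenceΨ, influence_eq_exp, exp_smul_symbolAt, neg_sum_sq_smul_add]
  simp [Matrix.fromBlocks_smul]

theorem influenceΨ_eq (t : ℝ) (p : EuclideanSpace ℝ (Fin d)) :
    𝓜.influenceΨ t p = fourierConst d • NormedSpace.exp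
      ((t : ℂ) • diracGenerator 𝓜.Γ 𝓜.massF fun a => Complex.I * (p a : ℂ)) := by
  rw [influenceΨ, influence_eq_exp, exp_smul_symbolAt]
  simp [Matrix.fromBlocks_smul]

theorem influence_zero (p : EuclideanSpace ℝ (Fin d)) :
    𝓜.firstOrderSystem.influence 0 p = fourierConst d • 1 := by
  simp [influence_eq_exp]

theorem hasDerivAt_influence (p : EuclideanSpace ℝ (Fin d)) (t : ℝ) (i j : Comp nB nF) :
    HasDerivAt (fun s => 𝓜.firstOrderSystem.influence s p i j)
      ((𝓜.firstOrderSystem.symbol p * 𝓜.firstOrderSystem.influence t p) i j) t := by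
  have h := (Matrix.hasDerivAt_exp_smul_apply t (𝓜.firstOrderSystem.symbol p) i j).const_smul
    (fourierConst d)
  rw [EvolutionSystem.influence, mul_smul_comm]
  exact h

theorem norm_diracGenerator_apply_le (k l : Fin nF) : ∃ C : ℝ, 0 ≤ C ∧
    ∀ (w : Fin d → ℂ) (ω : ℝ), 1 ≤ ω → (∀ a, ‖w a‖ ≤ 2 * ω) →
      ‖diracGenerator 𝓜.Γ 𝓜.massF w k l‖ ≤ C * ω := by
  set G := (𝓜.Γ 0)⁻¹.toComplex
  refine ⟨∑ j, ‖G k j‖ * ((∑ a : Fin d, 2 * ‖(𝓜.Γ a.succ).toComplex j l‖) +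
    ‖𝓜.massF.toComplex j l‖), by positivity, fun w ω hω hw => ?_⟩
  rw [diracGenerator, Matrix.neg_apply, norm_neg, Matrix.mul_apply, Finset.sum_mul]
  refine norm_sum_le_of_le _ fun j _ => ?_
  rw [norm_mul, mul_assoc]
  gcongr
  rw [Matrix.sub_apply, Matrix.sum_apply, add_mul, Finset.sum_mul]
  refine (norm_sub_le _ _).trans (add_le_add (norm_sum_le_of_le _ fun a _ => ?_) ?_)
  · rw [Matrix.smul_apply, smul_eq_mul, norm_mul]
    have := hw a
    calc _ ≤ 2 * ω * ‖(𝓜.Γ a.succ).toComplex j l‖ := by gcongr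
      _ = _ := by ring
  · exact le_mul_of_one_le_right (norm_nonneg _) hω

/-- Write the exponential as cosine plus `S` times sine: the entries of `S` are `O(ω)` and those of
the sine matrix carry `ω⁻¹`, so the fermionic block loses no power of `ω`. -/
theorem norm_exp_diracGenerator_apply_le : ∃ μ C : ℝ, 0 ≤ μ ∧ 0 ≤ C ∧
    ∀ (w : Fin d → ℂ) (ω η : ℝ), Matrix.IsNearSq (-∑ a, w a ^ 2) ω η → (∀ a, ‖w a‖ ≤ 2 * ω) →
      ∀ (t : ℝ) (k l : Fin nF), ‖NormedSpace.exp ((t : ℂ) • diracGenerator 𝓜.Γ 𝓜.massF w) k l‖ ≤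
        C * Real.exp (μ * |t|) * Real.exp (η * |t|) := by
  obtain ⟨K, M, hKM⟩ := 𝓜.exists_kleinGordonFactor
  obtain ⟨μ, hμ, h⟩ := Matrix.norm_sinSqrtDiv_cosSqrt_le (-M.toComplex)
  choose c hc0 hc using 𝓜.norm_diracGenerator_apply_le
  refine ⟨μ, 1 + ∑ k, ∑ l, c k l, hμ, ?_, fun w ω η hω hw t k l => ?_⟩
  · have := Finset.sum_nonneg fun k (_ : k ∈ Finset.univ) =>
      Finset.sum_nonneg fun l (_ : l ∈ Finset.univ) => hc0 k l
    linarith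
  have hω0 : 0 < ω := zero_lt_one.trans_le hω.one_le
  have hA : -(diracGenerator 𝓜.Γ 𝓜.massF w * diracGenerator 𝓜.Γ 𝓜.massF w) =
      (-∑ a, w a ^ 2) • 1 + -M.toComplex := by
    rw [diracGenerator_mul_self hKM, neg_add, neg_smul]
  rw [Matrix.exp_smul_eq_cosSqrt_add, hA, Matrix.add_apply, add_mul, add_mul, one_mul]
  have h' := h _ ω η hω t
  refine (norm_add_le _ _).trans (add_le_add (h' k l).2.1 ?_)
  rw [Matrix.mul_apply]
  set ε := Real.exp (μ * |t|) * Real.exp (η * |t|) with hε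
  calc _ ≤ ∑ j, c k j * ε := by
        refine norm_sum_le_of_le _ fun j _ => ?_
        rw [norm_mul]
        calc _ ≤ (c k j * ω) * (ω⁻¹ * ε) := by
              have h1 := hc k j w ω hω.one_le hw
              have h2 := (h' j l).1
              rw [mul_assoc, ← hε] at h2
              have := hc0 k j
              gcongr
          _ = _ := by field_simp
    _ = (∑ j, c k j) * ε := by rw [Finset.sum_mul]
    _ ≤ (∑ k, ∑ j, c k j) * ε := by
        refine mul_le_mul_of_nonneg_right ?_ (by positivity)
        exact Finset.single_le_sum (f := fun k => ∑ j, c k j)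
          (fun k _ => Finset.sum_nonneg fun j _ => hc0 k j) (Finset.mem_univ k)
    _ = _ := by rw [hε, mul_assoc]

/-- One bound serves twice: at real momenta (`η = 0`) for the smoothness offsets, and at complex
ones for the exponential type. -/
theorem norm_exp_symbolAt_apply_le : ∃ μ C : ℝ, 0 ≤ μ ∧ 0 < C ∧
    ∀ (w : Fin d → ℂ) (ω η : ℝ), Matrix.IsNearSq (-∑ a, w a ^ 2) ω η → (∀ a, ‖w a‖ ≤ 2 * ω) →
      ∀ (t : ℝ) (i j : Comp nB nF), ‖NormedSpace.exp ((t : ℂ) • 𝓜.firstOrderSystem.symbolAt w) i j‖ ≤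
        C * Real.exp (μ * |t|) * Real.exp (η * |t|) *
          ω ^ (offsets nB nF j - offsets nB nF i) := by
  obtain ⟨μ₁, hμ₁, h₁⟩ := Matrix.norm_sinSqrtDiv_cosSqrt_le 𝓜.massB.toComplex
  obtain ⟨μ₂, C₂, hμ₂, hC₂, h₂⟩ := 𝓜.norm_exp_diracGenerator_apply_le
  -- This constant dominates those of all the blocks, namely `1`, `4 + 2μ₁` and `C₂`.
  refine ⟨μ₁ + μ₂, 5 + 2 * μ₁ + C₂, by positivity, by positivity, fun w ω η hω hw t i j => ?_⟩
  have hω0 : 0 < ω := zero_lt_one.trans_le hω.one_le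
  have h₁' := h₁ _ ω η hω t
  have h₂' := h₂ w ω η hω hw t
  have e₁ : Real.exp (μ₁ * |t|) ≤ Real.exp ((μ₁ + μ₂) * |t|) := by
    gcongr; linarith
  have e₂ : Real.exp (μ₂ * |t|) ≤ Real.exp ((μ₁ + μ₂) * |t|) := by
    gcongr; linarith
  set ε := Real.exp (η * |t|)
  set ε' := Real.exp ((μ₁ + μ₂) * |t|)
  have key : ∀ (x c r e : ℝ), x ≤ c * e * ε * r → e ≤ ε' → 0 ≤ e → 0 ≤ c → 0 ≤ r →
      c ≤ 5 + 2 * μ₁ + C₂ → x ≤ (5 + 2 * μ₁ + C₂) * ε' * ε * r := by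
    intro x c r e hx he he0 hc hr hcC
    refine hx.trans ?_
    gcongr
  rw [exp_smul_symbolAt]
  rcases i with (i | i) | i <;> rcases j with (j | j) | j <;>
    simp only [Matrix.fromBlocks_apply₁₁, Matrix.fromBlocks_apply₁₂, Matrix.fromBlocks_apply₂₁,
      Matrix.fromBlocks_apply₂₂, Matrix.zero_apply, norm_zero, offsets, Sum.elim_inl, Sum.elim_inr,
      sub_self, zero_sub, sub_zero, zpow_zero, zpow_one, zpow_neg, Matrix.neg_apply, norm_neg]
  · exact key _ 1 1 _ (by simpa using (h₁' i j).2.1) e₁ (Real.exp_nonneg _) zero_le_one zero_le_one (by linarith)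
  · exact key _ 1 ω⁻¹ _ ((h₁' i j).1.trans (le_of_eq (by ring))) e₁ (Real.exp_nonneg _) zero_le_one (by positivity)
      (by linarith)
  · positivity
  · exact key _ (4 + 2 * μ₁) ω _ ((h₁' i j).2.2.trans (le_of_eq (by ring))) e₁ (Real.exp_nonneg _) (by positivity)
      hω0.le (by linarith)
  · exact key _ 1 1 _ (by simpa using (h₁' i j).2.1) e₁ (Real.exp_nonneg _) zero_le_one zero_le_one (by linarith)
  · positivity
  · positivity
  · positivity
  · exact key _ C₂ 1 _ (by simpa using h₂' i j) e₂ (Real.exp_nonneg _) hC₂ zero_le_one (by linarith)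

end FieldModel

/-! ### Integrals depending holomorphically on a parameter -/

section HolomorphicIntegral

open MeasureTheory Filter Topology

/-- A locally uniform integrable bound on `f` alone suffices: Cauchy's estimate on unit circles
bounds the derivative by the same function. -/
theorem differentiable_integral_of_dominated {α : Type*} [MeasurableSpace α] {μ : Measure α}
    {f : ℂ → α → ℂ} (hd : ∀ x, Differentiable ℂ fun z => f z x)
    (hm : ∀ z, AEStronglyMeasurable (f z) μ)
    (hb : ∀ R : ℝ, ∃ b : α → ℝ, Integrable b μ ∧ ∀ z, ‖z‖ ≤ R → ∀ x, ‖f z x‖ ≤ b x) :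
    Differentiable ℂ fun z => ∫ x, f z x ∂μ := by
  intro z₀
  -- One unit for the neighbourhood of `z₀`, one for the Cauchy circle around each of its points.
  obtain ⟨b, hbi, hb⟩ := hb (‖z₀‖ + 2)
  have hmeas : AEStronglyMeasurable (fun x => deriv (fun z => f z x) z₀) μ := by
    -- The derivative is measurable as a limit of difference quotients along this sequence.
    have hseq : Tendsto (fun n : ℕ => (1 / ((n : ℂ) + 1))) atTop (𝓝[≠] 0) :=
      tendsto_nhdsWithin_iff.2 ⟨tendsto_one_div_add_atTop_nhds_zero_nat, Eventually.of_forall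
        fun n => one_div_ne_zero (Nat.cast_add_one_ne_zero n)⟩
    refine aestronglyMeasurable_of_tendsto_ae atTop
      (f := fun (n : ℕ) x => (1 / ((n : ℂ) + 1))⁻¹ • (f (z₀ + 1 / ((n : ℂ) + 1)) x - f z₀ x))
      (fun n => ((hm (z₀ + 1 / ((n : ℂ) + 1))).sub (hm z₀)).const_smul (1 / ((n : ℂ) + 1))⁻¹) (Eventually.of_forall fun x => ?_)
    exact (hd x z₀).hasDerivAt.tendsto_slope_zero.comp hseq
  refine (hasDerivAt_integral_of_dominated_loc_of_deriv_le (bound := b)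
    (F' := fun z x => deriv (fun z => f z x) z)
    (Metric.ball_mem_nhds z₀ one_pos) (Eventually.of_forall hm)
    (hbi.mono' (hm z₀) (Eventually.of_forall fun x => hb z₀ (by linarith) x)) hmeas
    (Eventually.of_forall fun x z hz => ?_) hbi
    (Eventually.of_forall fun x z _ => (hd x z).hasDerivAt)).2.differentiableAt
  have h := Complex.norm_deriv_le_of_forall_mem_sphere_norm_le (c := z) (C := b x) one_pos
    (hd x).diffContOnCl fun y hy => hb y ?_ x
  · simpa using h
  · have h1 : ‖y - z‖ = 1 := by simpa using hy
    have h2 : ‖z - z₀‖ < 1 := by simpa [dist_eq_norm] using hz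
    have h3 : y = (y - z) + (z - z₀) + z₀ := by ring
    rw [h3]
    refine (norm_add₃_le).trans ?_
    linarith

/-- The integral of a holomorphic family whose real translations are spatial translations does not
depend on the parameter. -/
theorem integral_eq_integral_of_translation {V : Type*} [NormedAddCommGroup V] [NormedSpace ℝ V]
    [MeasurableSpace V] [BorelSpace V] {μ : Measure V} [μ.IsAddRightInvariant]
    {f : ℂ → V → ℂ} {e : V} (htr : ∀ (z : ℂ) (s : ℝ) p, f (z + s) p = f z (p + s • e))
    (hd : ∀ x, Differentiable ℂ fun z => f z x) (hm : ∀ z, AEStronglyMeasurable (f z) μ)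
    (hb : ∀ R : ℝ, ∃ b : V → ℝ, Integrable b μ ∧ ∀ z, ‖z‖ ≤ R → ∀ x, ‖f z x‖ ≤ b x) (z : ℂ) :
    ∫ x, f z x ∂μ = ∫ x, f 0 x ∂μ := by
  have hdiff := differentiable_integral_of_dominated hd hm hb
  refine is_const_of_deriv_eq_zero hdiff (fun z => ?_) z 0
  -- The complex derivative can be computed along the real direction, where translation invariance
  -- of the measure makes the integral constant.
  have h1 : HasDerivAt (fun s : ℂ => ∫ x, f (z + s) x ∂μ) (deriv (fun z => ∫ x, f z x ∂μ) z)
      ((0 : ℝ) : ℂ) := by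
    have := (hdiff z).hasDerivAt
    rw [← add_zero z] at this
    simpa using this.comp_const_add z 0
  have h2 : (fun s : ℝ => ∫ x, f (z + s) x ∂μ) = fun _ => ∫ x, f z x ∂μ := by
    funext s
    simp_rw [htr]
    exact integral_add_right_eq_self (f z) (s • e)
  have h3 := h1.comp_ofReal
  rw [h2] at h3
  exact h3.unique (hasDerivAt_const _ _)

end HolomorphicIntegral

/-! ### Decay of the Fourier-Laplace transform of test functions -/

section FourierLaplace

open MeasureTheory Filter Topology LineDeriv

variable {d : ℕ}

/-- The Fourier-Laplace transform of `φ` at the complex momentum `p + z e`. -/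
noncomputable def fourierLaplace (e : EuclideanSpace ℝ (Fin d))
    (φ : EuclideanSpace ℝ (Fin d) → ℂ) (z : ℂ) (p : EuclideanSpace ℝ (Fin d)) : ℂ :=
  ∫ x, Complex.exp (Complex.I * ((inner ℝ p x : ℝ) + z * (inner ℝ e x : ℝ))) * φ x

variable {e : EuclideanSpace ℝ (Fin d)} {φ : 𝓢(EuclideanSpace ℝ (Fin d), ℂ)}

theorem norm_fourierLaplace_integrand (e p x : EuclideanSpace ℝ (Fin d)) (z c : ℂ) :
    ‖Complex.exp (Complex.I * ((inner ℝ p x : ℝ) + z * (inner ℝ e x : ℝ))) * c‖ =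
      Real.exp (-z.im * inner ℝ e x) * ‖c‖ := by
  rw [norm_mul, Complex.norm_exp]
  simp

theorem continuous_fourierLaplace_phase (e p : EuclideanSpace ℝ (Fin d)) (z : ℂ) :
    Continuous fun x : EuclideanSpace ℝ (Fin d) =>
      Complex.exp (Complex.I * ((inner ℝ p x : ℝ) + z * (inner ℝ e x : ℝ))) := by
  fun_prop

theorem integrable_fourierLaplace (hφ : HasCompactSupport φ) (p : EuclideanSpace ℝ (Fin d))
    (z : ℂ) : Integrable fun x : EuclideanSpace ℝ (Fin d) =>
      Complex.exp (Complex.I * ((inner ℝ p x : ℝ) + z * (inner ℝ e x : ℝ))) * φ x :=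
  ((continuous_fourierLaplace_phase e p z).mul φ.continuous).integrable_of_hasCompactSupport
    hφ.mul_left

theorem fourierLaplace_add (φ : EuclideanSpace ℝ (Fin d) → ℂ) (z : ℂ) (s : ℝ)
    (p : EuclideanSpace ℝ (Fin d)) :
    fourierLaplace e φ (z + s) p = fourierLaplace e φ z (p + s • e) := by
  unfold fourierLaplace
  congr 1
  funext x
  rw [inner_add_left, real_inner_smul_left]
  push_cast
  ring_nf

theorem integrable_exp_mul_norm (hφ : HasCompactSupport φ) (c : ℝ) :
    Integrable fun x : EuclideanSpace ℝ (Fin d) => Real.exp (c * inner ℝ e x) * ‖φ x‖ := by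
  refine Continuous.integrable_of_hasCompactSupport ?_ hφ.norm.mul_left
  have := φ.continuous
  fun_prop

theorem continuous_fourierLaplace (hφ : HasCompactSupport φ) (z : ℂ) :
    Continuous (fourierLaplace e φ z) := by
  refine continuous_of_dominated (bound := fun x => Real.exp (-z.im * inner ℝ e x) * ‖φ x‖)
    (fun p => (integrable_fourierLaplace hφ p z).aestronglyMeasurable)
    (fun p => Eventually.of_forall fun x => (norm_fourierLaplace_integrand e p x z _).le)
    (integrable_exp_mul_norm hφ _) (Eventually.of_forall fun x => ?_)
  fun_prop

theorem differentiable_fourierLaplace (hφ : HasCompactSupport φ) (p : EuclideanSpace ℝ (Fin d)) :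
    Differentiable ℂ fun z => fourierLaplace e φ z p := by
  refine differentiable_integral_of_dominated (fun x => by fun_prop)
    (fun z => (integrable_fourierLaplace hφ p z).aestronglyMeasurable) fun R => ?_
  refine ⟨fun x => Real.exp (R * |inner ℝ e x|) * ‖φ x‖, ?_, fun z hz x => ?_⟩
  · refine Continuous.integrable_of_hasCompactSupport ?_ hφ.norm.mul_left
    have := φ.continuous
    fun_prop
  · rw [norm_fourierLaplace_integrand]
    refine mul_le_mul_of_nonneg_right (Real.exp_le_exp.2 ?_) (norm_nonneg _)
    refine (le_abs_self _).trans ?_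
    rw [abs_mul, abs_neg]
    exact mul_le_mul_of_nonneg_right ((Complex.abs_im_le_norm z).trans hz) (abs_nonneg _)

theorem hasCompactSupport_lineDerivOp (hφ : HasCompactSupport φ)
    (v : EuclideanSpace ℝ (Fin d)) :
    HasCompactSupport (∂_{v} φ : 𝓢(EuclideanSpace ℝ (Fin d), ℂ)) :=
  hφ.of_isClosed_subset (isClosed_tsupport _) (SchwartzMap.tsupport_lineDerivOp_subset v φ)

/-- Integration by parts; compact support supplies the integrability against the exponentially
growing phase. -/
theorem fourierLaplace_lineDerivOp (hφ : HasCompactSupport φ) (v p : EuclideanSpace ℝ (Fin d))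
    (z : ℂ) : fourierLaplace e (∂_{v} φ : 𝓢(EuclideanSpace ℝ (Fin d), ℂ)) z p =
      -(Complex.I * ((inner ℝ p v : ℝ) + z * (inner ℝ e v : ℝ))) * fourierLaplace e φ z p := by
  set F : EuclideanSpace ℝ (Fin d) → ℂ := fun x =>
    Complex.exp (Complex.I * ((inner ℝ p x : ℝ) + z * (inner ℝ e x : ℝ))) with hF
  have hdiff : Differentiable ℝ F := by
    have h1 : ∀ q : EuclideanSpace ℝ (Fin d),
        Differentiable ℝ fun x : EuclideanSpace ℝ (Fin d) => ((inner ℝ q x : ℝ) : ℂ) :=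
      fun q => Complex.ofRealCLM.differentiable.comp (innerSL ℝ q).differentiable
    exact (((h1 p).add ((h1 e).const_mul z)).const_mul Complex.I).cexp
  have hF' : ∀ x, fderiv ℝ F x v =
      (Complex.I * ((inner ℝ p v : ℝ) + z * (inner ℝ e v : ℝ))) * F x := by
    intro x
    rw [← (hdiff x).lineDeriv_eq_fderiv]
    refine HasLineDerivAt.lineDeriv ?_
    have h1 : ∀ q : EuclideanSpace ℝ (Fin d),
        HasDerivAt (fun s : ℝ => ((inner ℝ q (x + s • v) : ℝ) : ℂ)) (inner ℝ q v : ℝ) 0 := by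
      intro q
      refine HasDerivAt.ofReal_comp ?_
      simp only [inner_add_right, real_inner_smul_right]
      simpa using ((hasDerivAt_id (0 : ℝ)).mul_const (inner ℝ q v)).const_add (inner ℝ q x)
    have h2 := (((h1 p).add ((h1 e).const_mul z)).const_mul Complex.I).cexp
    refine h2.congr_deriv ?_
    simp [hF, mul_comm]
  have hint := integrable_fourierLaplace (e := e) hφ p z
  have h := integral_mul_fderiv_eq_neg_fderiv_mul_of_integrable (μ := volume) (f := F) (g := φ)
    (v := v) ?_ ?_ hint (fun x _ => hdiff x) (fun x _ => φ.differentiableAt)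
  · simp only [hF', mul_assoc, integral_const_mul] at h
    rw [fourierLaplace, fourierLaplace, neg_mul, mul_assoc]
    exact h
  · simpa only [hF', mul_assoc] using
      hint.const_mul (Complex.I * ((inner ℝ p v : ℝ) + z * (inner ℝ e v : ℝ)))
  · exact integrable_fourierLaplace (hasCompactSupport_lineDerivOp hφ v) p z

theorem norm_fourierLaplace_le {w : ℝ → ℝ}
    (hw : ∀ η, ∀ x ∈ tsupport φ, Real.exp (-η * inner ℝ e x) ≤ w η)
    (p : EuclideanSpace ℝ (Fin d)) (η : ℝ) :
    ‖fourierLaplace e φ (Complex.I * η) p‖ ≤ (∫ x, ‖φ x‖) * w η := by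
  rw [← integral_mul_const]
  refine norm_integral_le_of_norm_le (φ.integrable.norm.mul_const _)
    (Eventually.of_forall fun x => ?_)
  rw [norm_fourierLaplace_integrand, mul_comm]
  by_cases hx : x ∈ tsupport φ
  · have := hw η x hx
    simp only [Complex.mul_im, Complex.I_re, Complex.ofReal_im, mul_zero, Complex.I_im,
      Complex.ofReal_re, one_mul, zero_add]
    gcongr
  · simp [image_eq_zero_of_notMem_tsupport hx]

/-- The Laplacian acts as `-(p + iηe)² = -|p|² - 2iη p·e + η²`. The cross term is removed by `2η
∂_e`, leaving coefficients that depend on `η` only. -/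
theorem one_add_norm_sq_mul_fourierLaplace (he : ‖e‖ = 1) (hφ : HasCompactSupport φ)
    (p : EuclideanSpace ℝ (Fin d)) (η : ℝ) :
    (1 + (‖p‖ : ℂ) ^ 2) * fourierLaplace e φ (Complex.I * η) p =
      (1 - (η : ℂ) ^ 2) * fourierLaplace e φ (Complex.I * η) p +
      2 * η * fourierLaplace e (∂_{e} φ : 𝓢(EuclideanSpace ℝ (Fin d), ℂ)) (Complex.I * η) p -
      ∑ a : Fin d, fourierLaplace e (∂_{EuclideanSpace.single a (1 : ℝ)}
        (∂_{EuclideanSpace.single a (1 : ℝ)} φ) : 𝓢(EuclideanSpace ℝ (Fin d), ℂ))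
          (Complex.I * η) p := by
  have hI := Complex.I_sq
  have h1 : ∀ a : Fin d, fourierLaplace e (∂_{EuclideanSpace.single a (1 : ℝ)}
        (∂_{EuclideanSpace.single a (1 : ℝ)} φ) : 𝓢(EuclideanSpace ℝ (Fin d), ℂ))
          (Complex.I * η) p =
      ((η : ℂ) ^ 2 * (e a : ℂ) ^ 2 - (p a : ℂ) ^ 2 - 2 * Complex.I * η * ((p a : ℂ) * e a)) *
        fourierLaplace e φ (Complex.I * η) p := by
    intro a
    rw [fourierLaplace_lineDerivOp (hasCompactSupport_lineDerivOp hφ _),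
      fourierLaplace_lineDerivOp hφ]
    simp only [EuclideanSpace.inner_single_right, one_mul, conj_trivial]
    linear_combination (((p a : ℂ) + Complex.I * η * e a) ^ 2 - (η : ℂ) ^ 2 * (e a : ℂ) ^ 2) *
      fourierLaplace e φ (Complex.I * η) p * hI
  have hp : (‖p‖ : ℂ) ^ 2 = ∑ a, (p a : ℂ) ^ 2 := by
    rw [← Complex.ofReal_pow, EuclideanSpace.norm_sq_eq]; simp
  have hee : (∑ a, (e a : ℂ) ^ 2) = 1 := by
    have : ‖e‖ ^ 2 = 1 := by rw [he, one_pow]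
    rw [EuclideanSpace.norm_sq_eq] at this
    exact_mod_cast (by simpa using this : ∑ a, e a ^ 2 = 1)
  have hpe : ((inner ℝ p e : ℝ) : ℂ) = ∑ a, (p a : ℂ) * e a := by
    simp [PiLp.inner_apply, mul_comm]
  simp only [h1]
  rw [← Finset.sum_mul, Finset.sum_sub_distrib, Finset.sum_sub_distrib, ← Finset.mul_sum,
    ← Finset.mul_sum, hee, ← hp, ← hpe, fourierLaplace_lineDerivOp hφ, real_inner_self_eq_norm_sq,
    he]
  push_cast
  linear_combination (2 * (η : ℂ) ^ 2) * fourierLaplace e φ (Complex.I * η) p * hI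

/-- Each factor `1 + |p|²` is traded for derivatives of `φ` at the price of `(1 + |η|)²`. The
induction runs over all `φ`; the same weight `w` works throughout because differentiation does not
enlarge supports. -/
theorem exists_norm_fourierLaplace_decay {w : ℝ → ℝ} (he : ‖e‖ = 1) (N : ℕ) :
    ∀ (φ : 𝓢(EuclideanSpace ℝ (Fin d), ℂ)), HasCompactSupport φ →
      (∀ η, ∀ x ∈ tsupport φ, Real.exp (-η * inner ℝ e x) ≤ w η) → (∀ η, 0 ≤ w η) →
      ∃ C : ℝ, 0 ≤ C ∧ ∀ (p : EuclideanSpace ℝ (Fin d)) (η : ℝ),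
        (1 + ‖p‖ ^ 2) ^ N * ‖fourierLaplace e φ (Complex.I * η) p‖ ≤
          C * (1 + |η|) ^ (2 * N) * w η := by
  induction N with
  | zero =>
    intro φ hφ hw hw0
    refine ⟨∫ x, ‖φ x‖, integral_nonneg fun x => norm_nonneg _, fun p η => ?_⟩
    simpa using norm_fourierLaplace_le hw p η
  | succ N ih =>
    intro φ hφ hw hw0
    have hsub : ∀ v, ∀ ψ : 𝓢(EuclideanSpace ℝ (Fin d), ℂ),
        tsupport (∂_{v} ψ : 𝓢(EuclideanSpace ℝ (Fin d), ℂ)) ⊆ tsupport ψ :=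
      fun v ψ => SchwartzMap.tsupport_lineDerivOp_subset v ψ
    have hcs := fun v => hasCompactSupport_lineDerivOp hφ v
    obtain ⟨C₀, hC₀, h₀⟩ := ih φ hφ hw hw0
    obtain ⟨C₁, hC₁, h₁⟩ := ih _ (hcs e) (fun η x hx => hw η x (hsub _ _ hx)) hw0
    choose C₂ hC₂ h₂ using fun a : Fin d => ih _
      (hasCompactSupport_lineDerivOp (hcs (EuclideanSpace.single a (1 : ℝ)))
        (EuclideanSpace.single a (1 : ℝ)))
      (fun η x hx => hw η x (hsub _ _ (hsub _ _ hx))) hw0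
    have hC₂s : 0 ≤ ∑ a, C₂ a := Finset.sum_nonneg fun a _ => hC₂ a
    refine ⟨C₀ + 2 * C₁ + ∑ a, C₂ a, by positivity, fun p η => ?_⟩
    have hn : (1 + ‖p‖ ^ 2) * ‖fourierLaplace e φ (Complex.I * η) p‖ =
        ‖(1 + (‖p‖ : ℂ) ^ 2) * fourierLaplace e φ (Complex.I * η) p‖ := by
      rw [norm_mul]
      congr 1
      rw [← Complex.ofReal_pow, ← Complex.ofReal_one, ← Complex.ofReal_add, Complex.norm_real,
        Real.norm_of_nonneg (by positivity)]
    rw [pow_succ, mul_assoc, hn, one_add_norm_sq_mul_fourierLaplace he hφ]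
    have hη0 : (0 : ℝ) ≤ |η| := abs_nonneg η
    have hη1 : ‖(1 - (η : ℂ) ^ 2)‖ ≤ (1 + |η|) ^ 2 := by
      refine (norm_sub_le _ _).trans ?_
      rw [norm_one, norm_pow, Complex.norm_real, Real.norm_eq_abs]
      nlinarith
    have hη2 : ‖(2 * η : ℂ)‖ ≤ 2 * (1 + |η|) ^ 2 := by
      rw [norm_mul, Complex.norm_real, Real.norm_eq_abs, Complex.norm_two]
      nlinarith
    have hη3 : 1 ≤ (1 + |η|) ^ 2 := by nlinarith
    set L := (1 + |η|) ^ (2 * N) * w η with hL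
    have hL0 : 0 ≤ L := mul_nonneg (by positivity) (hw0 η)
    have e₀ := h₀ p η
    have e₁ := h₁ p η
    have e₂ := Finset.sum_le_sum fun a (_ : a ∈ Finset.univ) => h₂ a p η
    rw [mul_assoc, ← hL] at e₀ e₁
    simp only [mul_assoc, ← hL] at e₂
    rw [← Finset.sum_mul, ← Finset.mul_sum] at e₂
    set X := (1 + ‖p‖ ^ 2) ^ N
    have hX : 0 ≤ X := by positivity
    calc _ ≤ X * ((1 + |η|) ^ 2 * ‖fourierLaplace e φ (Complex.I * η) p‖ +
          2 * (1 + |η|) ^ 2 * ‖fourierLaplace e (∂_{e} φ : 𝓢(EuclideanSpace ℝ (Fin d), ℂ))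
            (Complex.I * η) p‖ + (1 + |η|) ^ 2 * ∑ a, ‖fourierLaplace e
              (∂_{EuclideanSpace.single a (1 : ℝ)} (∂_{EuclideanSpace.single a (1 : ℝ)} φ) :
                𝓢(EuclideanSpace ℝ (Fin d), ℂ)) (Complex.I * η) p‖) := by
          refine mul_le_mul_of_nonneg_left ?_ hX
          refine (norm_sub_le _ _).trans (add_le_add ((norm_add_le _ _).trans
            (add_le_add ?_ ?_)) ((norm_sum_le _ _).trans ?_))
          · rw [norm_mul]; gcongr
          · rw [norm_mul]; gcongr
          · exact le_mul_of_one_le_left (Finset.sum_nonneg fun a _ => norm_nonneg _) hη3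
      _ ≤ (1 + |η|) ^ 2 * (C₀ * L) + 2 * (1 + |η|) ^ 2 * (C₁ * L) +
          (1 + |η|) ^ 2 * ((∑ a, C₂ a) * L) := by
          rw [mul_add, mul_add, mul_left_comm X, mul_left_comm X, mul_left_comm X]
          gcongr
      _ = _ := by rw [hL]; ring

end FourierLaplace

/-! ### Paley-Wiener theorem by shifting the momentum integral -/

section PaleyWiener

open MeasureTheory Filter Topology

variable {d : ℕ}

theorem integrable_one_add_norm_sq_pow_inv :
    Integrable fun p : EuclideanSpace ℝ (Fin d) => ((1 + ‖p‖ ^ 2) ^ (d + 1))⁻¹ := by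
  have h := integrable_rpow_neg_one_add_norm_sq (E := EuclideanSpace ℝ (Fin d)) (μ := volume)
    (r := 2 * (d + 1 : ℝ)) (by simp; linarith)
  refine h.congr (Eventually.of_forall fun p => ?_)
  have h1 : -(2 * (d + 1 : ℝ)) / 2 = -((d + 1 : ℕ) : ℝ) := by push_cast; ring
  simp only [h1]
  rw [Real.rpow_neg (by positivity), Real.rpow_natCast]

theorem one_add_norm_sq_le_mul (p v : EuclideanSpace ℝ (Fin d)) :
    1 + ‖p‖ ^ 2 ≤ 2 * (1 + ‖v‖ ^ 2) * (1 + ‖p + v‖ ^ 2) := by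
  have h : ‖p‖ ≤ ‖p + v‖ + ‖v‖ := by simpa using norm_sub_le (p + v) v
  have h1 : ‖p‖ ^ 2 ≤ (‖p + v‖ + ‖v‖) ^ 2 := by gcongr
  nlinarith [sq_nonneg (‖p + v‖ - ‖v‖), mul_nonneg (sq_nonneg ‖v‖) (sq_nonneg ‖p + v‖)]

/-- `G` extends `g` to the complex momenta `p + z e`, with growth at most exponential of type `r`
in `Im z`. -/
structure IsExponentialExtension (g : EuclideanSpace ℝ (Fin d) → ℂ)
    (e : EuclideanSpace ℝ (Fin d)) (r : ℝ) (G : ℂ → EuclideanSpace ℝ (Fin d) → ℂ) : Prop where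
  zero_eq : ∀ p, G 0 p = g p
  add_eq : ∀ (z : ℂ) (s : ℝ) p, G (z + s) p = G z (p + s • e)
  differentiable : ∀ p, Differentiable ℂ fun z => G z p
  continuous : ∀ z, Continuous (G z)
  bound : ∃ (C : ℝ) (k : ℕ), 0 ≤ C ∧ ∀ p (η : ℝ),
    ‖G (Complex.I * η) p‖ ≤ C * (1 + ‖p‖ + |η|) ^ k * Real.exp (r * |η|)

variable {g : EuclideanSpace ℝ (Fin d) → ℂ} {e : EuclideanSpace ℝ (Fin d)} {r : ℝ}
  {G : ℂ → EuclideanSpace ℝ (Fin d) → ℂ} {φ : 𝓢(EuclideanSpace ℝ (Fin d), ℂ)}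

theorem IsExponentialExtension.exists_bound (hG : IsExponentialExtension g e r G)
    (he : ‖e‖ = 1) (hφ : HasCompactSupport φ) {w : ℝ → ℝ}
    (hw : ∀ η, ∀ x ∈ tsupport φ, Real.exp (-η * inner ℝ e x) ≤ w η) (hw0 : ∀ η, 0 ≤ w η) :
    ∃ (C : ℝ) (k : ℕ), 0 ≤ C ∧ ∀ p (η : ℝ),
      ‖G (Complex.I * η) p * fourierLaplace e φ (Complex.I * η) p‖ ≤
        C * (1 + |η|) ^ k * Real.exp (r * |η|) * w η * ((1 + ‖p‖ ^ 2) ^ (d + 1))⁻¹ := by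
  obtain ⟨C, k, hC, h⟩ := hG.bound
  -- Here `k` powers absorb the growth of `G`, and `d + 1` more make the integrand integrable.
  obtain ⟨C', hC', h'⟩ := exists_norm_fourierLaplace_decay he (k + (d + 1)) φ hφ hw hw0
  refine ⟨C * 2 ^ k * C', k + 2 * (k + (d + 1)), by positivity, fun p η => ?_⟩
  have hη : 0 ≤ |η| := abs_nonneg η
  have h1 : (1 + ‖p‖ + |η|) ^ k ≤ 2 ^ k * (1 + |η|) ^ k * (1 + ‖p‖ ^ 2) ^ k := by
    rw [← mul_pow, ← mul_pow]
    gcongr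
    nlinarith [norm_nonneg p, sq_nonneg (‖p‖ - 1), mul_nonneg hη (sq_nonneg ‖p‖)]
  set X := 1 + ‖p‖ ^ 2 with hX
  have hX0 : 0 < X := by positivity
  have h2 : X ^ k * ‖fourierLaplace e φ (Complex.I * η) p‖ ≤
      C' * (1 + |η|) ^ (2 * (k + (d + 1))) * w η * (X ^ (d + 1))⁻¹ := by
    rw [← div_eq_mul_inv, le_div_iff₀ (by positivity)]
    calc _ = X ^ (k + (d + 1)) * ‖fourierLaplace e φ (Complex.I * η) p‖ := by ring
      _ ≤ _ := h' p η
  rw [norm_mul]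
  calc _ ≤ (C * (2 ^ k * (1 + |η|) ^ k * X ^ k) * Real.exp (r * |η|)) *
        ‖fourierLaplace e φ (Complex.I * η) p‖ := by
        gcongr
        exact (h p η).trans (by gcongr)
    _ = (C * 2 ^ k * (1 + |η|) ^ k * Real.exp (r * |η|)) *
        (X ^ k * ‖fourierLaplace e φ (Complex.I * η) p‖) := by ring
    _ ≤ (C * 2 ^ k * (1 + |η|) ^ k * Real.exp (r * |η|)) *
        (C' * (1 + |η|) ^ (2 * (k + (d + 1))) * w η * (X ^ (d + 1))⁻¹) := by gcongr
    _ = _ := by rw [pow_add (1 + |η|)]; ring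

/-- With `y = 1 + η` the polynomial factor becomes a pure power, so for `a > r` the right side
visibly tends to zero. -/
theorem mul_le_pow_div_exp {C J a b y : ℝ} {k : ℕ} (hC : 0 ≤ C) (hJ : 0 ≤ J) (hab : a ≤ b)
    (hy : 1 ≤ y) :
    C * y ^ k * Real.exp (r * (y - 1)) * (Real.exp (-(y - 1) * a) + Real.exp (-(y - 1) * b)) * J ≤
      2 * C * J * Real.exp (a - r) * (y ^ k / Real.exp ((a - r) * y)) := by
  have h1 : Real.exp (-(y - 1) * b) ≤ Real.exp (-(y - 1) * a) :=
    Real.exp_le_exp.2 (by nlinarith)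
  have h2 : Real.exp (-(y - 1) * a) + Real.exp (-(y - 1) * b) ≤ 2 * Real.exp (-(y - 1) * a) := by
    linarith
  have h3 : Real.exp (r * (y - 1)) * Real.exp (-(y - 1) * a) =
      Real.exp (a - r) / Real.exp ((a - r) * y) := by
    rw [← Real.exp_add, ← Real.exp_sub]; congr 1; ring
  have h0 : 0 ≤ C * y ^ k * Real.exp (r * (y - 1)) := by positivity
  refine (mul_le_mul_of_nonneg_right (mul_le_mul_of_nonneg_left h2 h0) hJ).trans (le_of_eq ?_)
  linear_combination (2 * C * J * y ^ k) * h3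

/-- Shifting the integral to `p + iηe` keeps its value, while the integrand is bounded by a
polynomial in `η` times `e^{-(a-r)η}` times a fixed integrable function. Let `η → ∞`. -/
theorem IsExponentialExtension.integral_eq_zero (hG : IsExponentialExtension g e r G)
    (he : ‖e‖ = 1) (hφ : HasCompactSupport φ) {a b : ℝ} (hra : r < a) (hab : a ≤ b)
    (hsupp : ∀ x ∈ tsupport φ, a ≤ inner ℝ e x ∧ inner ℝ e x ≤ b) :
    ∫ p, g p * fourierLaplace e φ 0 p = 0 := by
  -- The term with `b` handles negative `η`, needed to dominate the integrand on full discs of `z`.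
  set w : ℝ → ℝ := fun η => Real.exp (-η * a) + Real.exp (-η * b) with hw
  have hwb : ∀ η, ∀ x ∈ tsupport φ, Real.exp (-η * inner ℝ e x) ≤ w η := by
    intro η x hx
    obtain ⟨h1, h2⟩ := hsupp x hx
    rcases le_total 0 η with hη | hη
    · refine le_add_of_le_of_nonneg (Real.exp_le_exp.2 ?_) (Real.exp_nonneg _)
      nlinarith
    · refine le_add_of_nonneg_of_le (Real.exp_nonneg _) (Real.exp_le_exp.2 ?_)
      nlinarith
  obtain ⟨C, k, hC, hb⟩ := hG.exists_bound he hφ hwb fun η => by positivity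
  have htr : ∀ (z : ℂ) (s : ℝ) p, G (z + s) p * fourierLaplace e φ (z + s) p =
      G z (p + s • e) * fourierLaplace e φ z (p + s • e) := by
    intro z s p
    rw [hG.add_eq, fourierLaplace_add]
  have hI := integral_eq_integral_of_translation (μ := volume) (e := e)
    (f := fun z p => G z p * fourierLaplace e φ z p) htr
    (fun p => (hG.differentiable p).mul (differentiable_fourierLaplace hφ p))
    (fun z => ((hG.continuous z).mul (continuous_fourierLaplace hφ z)).aestronglyMeasurable)
    (fun R => ?_)
  · set J := ∫ p : EuclideanSpace ℝ (Fin d), ((1 + ‖p‖ ^ 2) ^ (d + 1))⁻¹ with hJ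
    have hJ0 : 0 ≤ J := integral_nonneg fun p => by positivity
    have hle : ∀ y : ℝ, 1 ≤ y → ‖∫ p, g p * fourierLaplace e φ 0 p‖ ≤
        2 * C * J * Real.exp (a - r) * (y ^ k / Real.exp ((a - r) * y)) := by
      intro y hy
      have h1 : ∫ p, g p * fourierLaplace e φ 0 p =
          ∫ p, G (Complex.I * (y - 1 : ℝ)) p * fourierLaplace e φ (Complex.I * (y - 1 : ℝ)) p := by
        rw [hI]; simp only [hG.zero_eq]
      rw [h1]
      refine (norm_integral_le_of_norm_le (integrable_one_add_norm_sq_pow_inv.const_mul _)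
        (Eventually.of_forall fun p => hb p (y - 1))).trans ?_
      rw [integral_const_mul, ← hJ, abs_of_nonneg (by linarith), add_sub_cancel]
      exact mul_le_pow_div_exp hC hJ0 hab hy
    have hlim := ((isLittleO_pow_exp_pos_mul_atTop k (sub_pos.2 hra)).tendsto_div_nhds_zero).const_mul
      (2 * C * J * Real.exp (a - r))
    rw [mul_zero] at hlim
    exact norm_le_zero_iff.1 (ge_of_tendsto hlim ((eventually_ge_atTop 1).mono hle))
  · refine ⟨fun p => (C * (1 + R) ^ k * Real.exp (|r| * R) *
      (Real.exp (R * |a|) + Real.exp (R * |b|)) * (2 * (1 + R ^ 2)) ^ (d + 1)) *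
      ((1 + ‖p‖ ^ 2) ^ (d + 1))⁻¹, integrable_one_add_norm_sq_pow_inv.const_mul _,
      fun z hz p => ?_⟩
    have hzz : z = Complex.I * z.im + (z.re : ℝ) := by
      rw [add_comm, mul_comm]; exact (Complex.re_add_im z).symm
    have hre : |z.re| ≤ R := (Complex.abs_re_le_norm z).trans hz
    have him : |z.im| ≤ R := (Complex.abs_im_le_norm z).trans hz
    have hR : 0 ≤ R := (abs_nonneg _).trans hre
    -- The real part of `z` is a translation of `p`; undoing it in the integrable weight costs a
    -- power of `2(1 + R²)`.
    have h1 := hb (p + z.re • e) z.im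
    rw [← htr, ← hzz] at h1
    refine h1.trans ?_
    have h2 : w z.im ≤ Real.exp (R * |a|) + Real.exp (R * |b|) := by
      have h3 : ∀ c : ℝ, Real.exp (-z.im * c) ≤ Real.exp (R * |c|) := by
        intro c
        refine Real.exp_le_exp.2 ((le_abs_self _).trans ?_)
        rw [abs_mul, abs_neg]
        exact mul_le_mul_of_nonneg_right him (abs_nonneg _)
      exact add_le_add (h3 a) (h3 b)
    have h4 : Real.exp (r * |z.im|) ≤ Real.exp (|r| * R) := by
      refine Real.exp_le_exp.2 (mul_le_mul (le_abs_self r) him (abs_nonneg _) (abs_nonneg _))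
    have h5 : ((1 + ‖p + z.re • e‖ ^ 2) ^ (d + 1))⁻¹ ≤
        (2 * (1 + R ^ 2)) ^ (d + 1) * ((1 + ‖p‖ ^ 2) ^ (d + 1))⁻¹ := by
      rw [← div_eq_mul_inv, le_div_iff₀ (by positivity), inv_mul_le_iff₀ (by positivity),
        ← mul_pow]
      gcongr
      refine (one_add_norm_sq_le_mul p (z.re • e)).trans ?_
      rw [norm_smul, he, mul_one, Real.norm_eq_abs, mul_comm]
      gcongr
    have h0 : 0 ≤ w z.im := by positivity
    refine le_trans ?_ (mul_assoc _ _ _).ge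
    gcongr

/-- A continuous function of polynomial growth acts on Schwartz functions by integration. -/
theorem exists_clm_eq_integral_mul {C : ℝ} {k : ℕ} (hg : Continuous g) (hC : 0 ≤ C)
    (hb : ∀ p, ‖g p‖ ≤ C * (1 + ‖p‖) ^ k) :
    ∃ T : 𝓢(EuclideanSpace ℝ (Fin d), ℂ) →L[ℂ] ℂ, ∀ ψ : 𝓢(EuclideanSpace ℝ (Fin d), ℂ),
      Integrable (fun p => g p * ψ p) ∧ T ψ = ∫ p, g p * ψ p := by
  obtain ⟨n, hn⟩ := (inferInstance : (volume : Measure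
    (EuclideanSpace ℝ (Fin d))).HasTemperateGrowth).exists_integrable
  have key : ∀ (ψ : 𝓢(EuclideanSpace ℝ (Fin d), ℂ)) p, ‖g p * ψ p‖ ≤
      (1 + ‖p‖) ^ (-(n : ℝ)) * (C * (2 ^ (k + n) *
        ((Finset.Iic (k + n, 0)).sup (schwartzSeminormFamily ℂ (EuclideanSpace ℝ (Fin d)) ℂ) ψ))) := by
    intro ψ p
    have h1 := SchwartzMap.one_add_le_sup_seminorm_apply (𝕜 := ℂ) (m := (k + n, 0)) (k := k + n)
      (n := 0) le_rfl le_rfl ψ p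
    rw [norm_iteratedFDeriv_zero] at h1
    rw [norm_mul, Real.rpow_neg (by positivity), Real.rpow_natCast, ← div_eq_inv_mul,
      le_div_iff₀ (by positivity)]
    calc _ ≤ (C * (1 + ‖p‖) ^ k) * ‖ψ p‖ * (1 + ‖p‖) ^ n := by gcongr; exact hb p
      _ = C * ((1 + ‖p‖) ^ (k + n) * ‖ψ p‖) := by rw [pow_add]; ring
      _ ≤ _ := mul_le_mul_of_nonneg_left h1 hC
  have hint : ∀ ψ : 𝓢(EuclideanSpace ℝ (Fin d), ℂ), Integrable (fun p => g p * ψ p) := fun ψ =>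
    (hn.mul_const _).mono' (hg.mul ψ.continuous).aestronglyMeasurable
      (Eventually.of_forall (key ψ))
  refine ⟨SchwartzMap.mkCLMtoNormedSpace (fun ψ => ∫ p, g p * ψ p) (fun ψ χ => ?_)
    (fun c ψ => ?_) ⟨Finset.Iic (k + n, 0), (∫ p : EuclideanSpace ℝ (Fin d),
      (1 + ‖p‖) ^ (-(n : ℝ))) * (C * 2 ^ (k + n)), ?_, fun ψ => ?_⟩, fun ψ => ⟨hint ψ, rfl⟩⟩
  · rw [← integral_add (hint ψ) (hint χ)]
    simp [mul_add]
  · rw [RingHom.id_apply, smul_eq_mul, ← integral_const_mul]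
    simp [mul_left_comm]
  · exact mul_nonneg (integral_nonneg fun p => by positivity) (by positivity)
  · refine (norm_integral_le_of_norm_le (hn.mul_const _)
      (Eventually.of_forall (key ψ))).trans (le_of_eq ?_)
    rw [integral_mul_const]
    ring

theorem fourierLaplace_zero (e p : EuclideanSpace ℝ (Fin d))
    (φ : EuclideanSpace ℝ (Fin d) → ℂ) :
    fourierLaplace e φ 0 p = ∫ x, Complex.exp (Complex.I * (inner ℝ p x : ℝ)) * φ x := by
  simp [fourierLaplace]

/-- The transform `∫ exp(i p x) φ(x) dx` as a continuous operator on Schwartz functions. -/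
theorem exists_clm_eq_integral_exp_mul :
    ∃ T : 𝓢(EuclideanSpace ℝ (Fin d), ℂ) →L[ℂ] 𝓢(EuclideanSpace ℝ (Fin d), ℂ), ∀ φ p,
      T φ p = ∫ x, Complex.exp (Complex.I * (inner ℝ p x : ℝ)) * φ x := by
  have hc : (2 * Real.pi)⁻¹ ≠ 0 := by positivity
  -- The dilation by `(2π)⁻¹` removes the `2π` from the phase of Mathlib's inverse Fourier
  -- transform.
  refine ⟨(SchwartzMap.compCLMOfContinuousLinearEquiv ℂ (ContinuousLinearEquiv.smulLeft (R₁ := ℝ)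
    (M₁ := EuclideanSpace ℝ (Fin d)) (Units.mk0 _ hc))).comp (FourierTransform.fourierInvCLM ℂ 𝓢(EuclideanSpace ℝ (Fin d), ℂ)), fun φ p => ?_⟩
  have h : ∀ q : EuclideanSpace ℝ (Fin d), FourierTransform.fourierInvCLM ℂ
      𝓢(EuclideanSpace ℝ (Fin d), ℂ) φ q = ∫ x, Complex.exp
        (((2 * Real.pi * inner ℝ x q : ℝ) : ℂ) * Complex.I) • φ x := fun q => by
    rw [FourierTransform.fourierInvCLM_apply, SchwartzMap.fourierInv_coe, Real.fourierInv_eq']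
  change FourierTransform.fourierInvCLM ℂ
      𝓢(EuclideanSpace ℝ (Fin d), ℂ) φ ((2 * Real.pi)⁻¹ • p) = _
  rw [h]
  congr 1
  funext x
  rw [real_inner_smul_right, mul_inv_cancel_left₀ (by positivity), real_inner_comm, smul_eq_mul,
    mul_comm Complex.I]

/-- A Paley-Wiener theorem: the inverse Fourier transform of a function which has extensions of
exponential type `r` in all directions is supported in the ball of radius `r`. -/
theorem exists_isInverseFourier {C : ℝ} {k : ℕ} (hg : Continuous g) (hC : 0 ≤ C)
    (hb : ∀ p, ‖g p‖ ≤ C * (1 + ‖p‖) ^ k) (hr : 0 ≤ r)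
    (hext : ∀ e, ‖e‖ = 1 → ∃ G, IsExponentialExtension g e r G) :
    ∃ u : 𝓢'(EuclideanSpace ℝ (Fin d), ℂ),
      EvolutionSystem.IsInverseFourier g u ∧ Distribution.dsupport u ⊆ {x | ‖x‖ ≤ r} := by
  obtain ⟨T, hT⟩ := exists_clm_eq_integral_mul hg hC hb
  obtain ⟨F, hF⟩ := exists_clm_eq_integral_exp_mul (d := d)
  refine ⟨ContinuousLinearMap.toPointwiseConvergenceCLM ℂ (RingHom.id ℂ) _ _ (fourierConst d • T.comp F), ?_, ?_⟩
  · intro φ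
    have := hT (F φ)
    simp only [hF] at this
    refine ⟨this.1, ?_⟩
    change fourierConst d * T (F φ) = _
    rw [this.2]
  · intro x hx
    by_contra hxr
    have hxr' : r < ‖x‖ := not_le.1 hxr
    have hx0 : 0 < ‖x‖ := hr.trans_lt hxr'
    -- Half the gap keeps `⟨e, y⟩ ≥ ‖x‖ - δ > r` on the ball around `x`, with `e` the direction of
    -- `x`.
    set δ := (‖x‖ - r) / 2 with hδ
    have hδ0 : 0 < δ := by rw [hδ]; linarith
    refine (Distribution.notMem_dsupport_iff x).2 ⟨Metric.ball x δ, fun φ hφ => ?_,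
      Metric.isOpen_ball, Metric.mem_ball_self hδ0⟩ hx
    have hcs : HasCompactSupport φ := (isCompact_closedBall x δ).of_isClosed_subset
      (isClosed_tsupport _) (hφ.trans Metric.ball_subset_closedBall)
    set e := ‖x‖⁻¹ • x with he
    have he1 : ‖e‖ = 1 := by rw [he, norm_smul, norm_inv, norm_norm, inv_mul_cancel₀ hx0.ne']
    obtain ⟨G, hG⟩ := hext e he1
    have hex : inner ℝ e x = ‖x‖ := by
      rw [he, real_inner_smul_left, real_inner_self_eq_norm_sq, pow_two,
        inv_mul_cancel_left₀ hx0.ne']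
    have hz := hG.integral_eq_zero he1 hcs (a := ‖x‖ - δ) (b := ‖x‖ + δ) (by rw [hδ]; linarith)
      (by linarith) fun y hy => by
        have h1 : |inner ℝ e (y - x)| ≤ δ := by
          refine (abs_real_inner_le_norm _ _).trans ?_
          rw [he1, one_mul]
          exact (mem_ball_iff_norm.1 (hφ hy)).le
        rw [inner_sub_right, hex, abs_le] at h1
        exact ⟨by linarith [h1.1], by linarith [h1.2]⟩
    have h2 := (hT (F φ)).2
    simp only [hF] at h2
    simp only [fourierLaplace_zero] at hz
    change fourierConst d * T (F φ) = 0
    rw [h2, hz, mul_zero]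

end PaleyWiener

/-! ### Complex momenta and the comparison frequency `ω` -/

section ComplexMomentum

variable {d : ℕ}

/-- `I (p + z e)` for complex `z`. -/
noncomputable def complexMomentum (e : EuclideanSpace ℝ (Fin d)) (z : ℂ)
    (p : EuclideanSpace ℝ (Fin d)) (a : Fin d) : ℂ :=
  Complex.I * ((p a : ℂ) + z * e a)

theorem neg_sum_complexMomentum_sq (e p : EuclideanSpace ℝ (Fin d)) (z : ℂ) :
    -∑ a, complexMomentum e z p a ^ 2 =
      (‖p‖ : ℂ) ^ 2 + 2 * z * (inner ℝ p e : ℝ) + z ^ 2 * (‖e‖ : ℂ) ^ 2 := by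
  have h : ∀ q : EuclideanSpace ℝ (Fin d), (‖q‖ : ℂ) ^ 2 = ∑ a, (q a : ℂ) ^ 2 := fun q => by
    rw [← Complex.ofReal_pow, EuclideanSpace.norm_sq_eq]; simp
  have hpe : ((inner ℝ p e : ℝ) : ℂ) = ∑ a, (p a : ℂ) * e a := by
    simp [PiLp.inner_apply, mul_comm]
  rw [h, h, hpe, Finset.mul_sum, Finset.mul_sum, ← Finset.sum_neg_distrib,
    ← Finset.sum_add_distrib, ← Finset.sum_add_distrib]
  refine Finset.sum_congr rfl fun a _ => ?_
  rw [complexMomentum, mul_pow, Complex.I_sq]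
  ring

/-- For `z = (p + iηe)²` one has `ω² - z = 1 + η²(1 + |e|²) - 2iη p·e`. Apart from the 1, its
modulus is at most `2|η|√(η² + |p|²) ≤ 2|η|ω`; this factor 2 yields the type `|t|`. Allowing `|e| ≤
1` includes `e = 0`. -/
theorem isNearSq_complexMomentum {e : EuclideanSpace ℝ (Fin d)} (he : ‖e‖ ≤ 1)
    (p : EuclideanSpace ℝ (Fin d)) (η : ℝ) :
    Matrix.IsNearSq (-∑ a, complexMomentum e (Complex.I * η) p a ^ 2)
      (√(1 + ‖p‖ ^ 2 + η ^ 2)) |η| := by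
  have hω : √(1 + ‖p‖ ^ 2 + η ^ 2) ^ 2 = 1 + ‖p‖ ^ 2 + η ^ 2 := Real.sq_sqrt (by positivity)
  have hω0 := Real.sqrt_nonneg (1 + ‖p‖ ^ 2 + η ^ 2)
  refine ⟨?_, abs_nonneg _, ?_, ?_⟩
  · rw [Real.one_le_sqrt]; nlinarith [sq_nonneg ‖p‖, sq_nonneg η]
  · exact Real.abs_le_sqrt (by nlinarith [sq_nonneg ‖p‖])
  · rw [neg_sum_complexMomentum_sq, ← Complex.ofReal_pow, hω]
    have h1 : (((1 + ‖p‖ ^ 2 + η ^ 2 : ℝ)) : ℂ) - ((‖p‖ : ℂ) ^ 2 +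
        2 * (Complex.I * η) * (inner ℝ p e : ℝ) + (Complex.I * η) ^ 2 * (‖e‖ : ℂ) ^ 2) =
        1 + (((η ^ 2 * (1 + ‖e‖ ^ 2) : ℝ) : ℂ) +
          ((-(2 * η * inner ℝ p e) : ℝ) : ℂ) * Complex.I) := by
      push_cast
      linear_combination (-(η : ℂ) ^ 2 * (‖e‖ : ℂ) ^ 2) * Complex.I_sq
    rw [h1]
    refine (norm_add_le _ _).trans ?_
    rw [norm_one, Complex.norm_add_mul_I]
    gcongr
    have hpe : |inner ℝ p e| ≤ ‖p‖ := (abs_real_inner_le_norm p e).trans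
      (mul_le_of_le_one_right (norm_nonneg _) he)
    have hpe2 : (inner ℝ p e) ^ 2 ≤ ‖p‖ ^ 2 := sq_le_sq' (abs_le.1 hpe).1 (abs_le.1 hpe).2
    refine Real.sqrt_le_iff.2 ⟨by positivity, ?_⟩
    rw [mul_pow, mul_pow _ (√_), mul_pow 2 |η|, sq_abs, hω]
    have he2 : ‖e‖ ^ 2 ≤ 1 := pow_le_one₀ (norm_nonneg _) he
    have h2 : (1 + ‖e‖ ^ 2) ^ 2 ≤ 2 ^ 2 := by gcongr; linarith
    have h3 := mul_le_mul_of_nonneg_left h2 (by positivity : 0 ≤ η ^ 2 * η ^ 2)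
    have h4 := mul_le_mul_of_nonneg_left hpe2 (sq_nonneg η)
    nlinarith [sq_nonneg η]

theorem norm_complexMomentum_le {e : EuclideanSpace ℝ (Fin d)} (he : ‖e‖ ≤ 1)
    (p : EuclideanSpace ℝ (Fin d)) (η : ℝ) (a : Fin d) :
    ‖complexMomentum e (Complex.I * η) p a‖ ≤ 2 * √(1 + ‖p‖ ^ 2 + η ^ 2) := by
  have h1 : ‖p‖ ≤ √(1 + ‖p‖ ^ 2 + η ^ 2) := Real.le_sqrt_of_sq_le (by nlinarith [sq_nonneg η])
  have h2 : |η| ≤ √(1 + ‖p‖ ^ 2 + η ^ 2) := Real.abs_le_sqrt (by nlinarith [sq_nonneg ‖p‖])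
  have hp : |p a| ≤ ‖p‖ := PiLp.norm_apply_le p a
  have hea : |e a| ≤ 1 := (PiLp.norm_apply_le e a).trans he
  rw [complexMomentum, norm_mul, Complex.norm_I, one_mul]
  refine (norm_add_le _ _).trans ?_
  rw [norm_mul, norm_mul, Complex.norm_I, one_mul, Complex.norm_real, Complex.norm_real,
    Complex.norm_real, Real.norm_eq_abs, Real.norm_eq_abs, Real.norm_eq_abs]
  have := mul_le_of_le_one_right (abs_nonneg η) hea
  linarith

end ComplexMomentum

/-! ### Admissibility and causality of the model -/

namespace FieldModel

variable {d nB nF : ℕ} (𝓜 : FieldModel d nB nF)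

theorem offsets_sub_mem (i j : Comp nB nF) :
    offsets nB nF j - offsets nB nF i = -1 ∨ offsets nB nF j - offsets nB nF i = 0 ∨
      offsets nB nF j - offsets nB nF i = 1 := by
  rcases i with (i | i) | i <;> rcases j with (j | j) | j <;> simp [offsets]

theorem influence_eq_complexMomentum (t : ℝ) (p : EuclideanSpace ℝ (Fin d)) :
    𝓜.firstOrderSystem.influence t p = fourierConst d • NormedSpace.exp
      ((t : ℂ) • 𝓜.firstOrderSystem.symbolAt (complexMomentum 0 (Complex.I * (0 : ℝ)) p)) := by
  rw [influence_eq_exp]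
  congr 4
  funext a
  simp [complexMomentum]

theorem exists_norm_influence_le (T : ℝ) : ∃ C : ℝ, 0 < C ∧ ∀ t : ℝ, |t| ≤ T → ∀ p i j,
    ‖𝓜.firstOrderSystem.influence t p i j‖ ≤
      C * (1 + ‖p‖) ^ (offsets nB nF j - offsets nB nF i) := by
  obtain ⟨μ, C, hμ, hC, h⟩ := 𝓜.norm_exp_symbolAt_apply_le
  refine ⟨(‖fourierConst d‖ + 1) * (C * Real.exp (μ * T)) * 2, by positivity,
    fun t ht p i j => ?_⟩
  -- With `e = 0` and `η = 0` the momentum is real and `ω = √(1 + |p|²)` lies between `(1 + |p|)/2`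
  -- and `1 + |p|`, which converts powers of `ω` into powers of `1 + |p|`.
  have h1 := h _ _ _ (isNearSq_complexMomentum (e := 0) (by simp) p 0)
    (norm_complexMomentum_le (by simp) p 0) t i j
  rw [influence_eq_complexMomentum, Matrix.smul_apply, smul_eq_mul, norm_mul]
  set ω := √(1 + ‖p‖ ^ 2 + 0 ^ 2) with hω
  have hω2 : ω ^ 2 = 1 + ‖p‖ ^ 2 := by rw [hω, Real.sq_sqrt (by positivity)]; ring
  have hω0 : 0 < ω := Real.sqrt_pos.2 (by positivity)
  have hp := norm_nonneg p
  have hle : ω ≤ 1 + ‖p‖ := by nlinarith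
  have hge : 1 + ‖p‖ ≤ 2 * ω := by nlinarith [sq_nonneg (‖p‖ - 1)]
  have h2 : ω ^ (offsets nB nF j - offsets nB nF i) ≤
      2 * (1 + ‖p‖) ^ (offsets nB nF j - offsets nB nF i) := by
    rcases offsets_sub_mem i j with h | h | h <;> rw [h]
    · rw [zpow_neg_one, zpow_neg_one, ← div_eq_mul_inv, inv_eq_one_div,
        div_le_div_iff₀ hω0 (by positivity)]
      linarith
    · simp
    · rw [zpow_one, zpow_one]; linarith
  have h3 : Real.exp (μ * |t|) ≤ Real.exp (μ * T) := by gcongr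
  rw [abs_zero, zero_mul, Real.exp_zero, mul_one] at h1
  calc _ ≤ (‖fourierConst d‖ + 1) * (C * Real.exp (μ * T) *
        (2 * (1 + ‖p‖) ^ (offsets nB nF j - offsets nB nF i))) := by
        refine mul_le_mul (by linarith) (h1.trans ?_) (norm_nonneg _) (by positivity)
        gcongr
    _ = _ := by ring

theorem isAdmissible : 𝓜.firstOrderSystem.IsAdmissible (offsets nB nF) where
  lin_even_odd _ _ := rfl
  lin_odd_even _ _ := rfl
  int_even b := (𝓜.supportedOn_int_inl b).mono fun _ _ h => h.1
  int_odd f := (𝓜.supportedOn_int_inr f).mono fun _ _ h => h.1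
  int_real := 𝓜.isReal_int
  int_entire := 𝓜.isEntire_int
  int_lowerDegree := 𝓜.lowerDegreeGE_int
  int_order_even := 𝓜.int_order_even
  int_order_odd := 𝓜.int_order_odd
  influence_bound T _ := 𝓜.exists_norm_influence_le T

theorem exists_isExponentialExtension (t : ℝ) (i j : Comp nB nF) {e : EuclideanSpace ℝ (Fin d)}
    (he : ‖e‖ ≤ 1) : ∃ G, IsExponentialExtension
      (fun p => 𝓜.firstOrderSystem.influence t p i j) e |t| G := by
  refine ⟨fun z p => fourierConst d * NormedSpace.exp
    ((t : ℂ) • 𝓜.firstOrderSystem.symbolAt (complexMomentum e z p)) i j, ?_, ?_, ?_, ?_, ?_⟩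
  · intro p
    have h0 : complexMomentum e 0 p = fun a => Complex.I * (p a : ℂ) := by
      funext a; simp [complexMomentum]
    rw [influence_eq_exp, Matrix.smul_apply, smul_eq_mul, h0]
  · intro z s p
    have h0 : complexMomentum e (z + s) p = complexMomentum e z (p + s • e) := by
      funext a; simp [complexMomentum]; ring
    rw [h0]
  · intro p
    refine (Matrix.differentiable_exp_apply (fun k l => ?_) i j).const_mul _
    refine (𝓜.firstOrderSystem.differentiable_symbolAt_comp (fun a => ?_) k l).const_mul _
    unfold complexMomentum
    fun_prop
  · intro z
    refine (Matrix.continuous_exp_apply ?_ i j).const_mul _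
    have hw : ∀ a, Continuous fun p => complexMomentum e z p a := fun a => by
      unfold complexMomentum
      fun_prop
    exact (𝓜.firstOrderSystem.continuous_symbolAt_comp hw).const_smul (t : ℂ)
  · obtain ⟨μ, C, hμ, hC, h⟩ := 𝓜.norm_exp_symbolAt_apply_le
    -- Degree 1 is enough because offsets differ by at most 1; the factor `e^{μ|t|}` is a constant
    -- here as `t` is fixed.
    refine ⟨‖fourierConst d‖ * (C * Real.exp (μ * |t|)), 1, by positivity, fun p η => ?_⟩
    have h1 := h _ _ _ (isNearSq_complexMomentum he p η) (norm_complexMomentum_le he p η) t i j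
    have hω1 := (isNearSq_complexMomentum he p η).one_le
    set ω := √(1 + ‖p‖ ^ 2 + η ^ 2) with hω
    have h2 : ω ^ (offsets nB nF j - offsets nB nF i) ≤ 1 + ‖p‖ + |η| := by
      calc _ ≤ ω ^ (1 : ℤ) := zpow_le_zpow_right₀ hω1 (by have := offsets_sub_mem i j; omega)
        _ = ω := zpow_one _
        _ ≤ 1 + ‖p‖ + |η| := by
          refine Real.sqrt_le_iff.2 ⟨by positivity, ?_⟩
          nlinarith [norm_nonneg p, abs_nonneg η, sq_abs η,
            mul_nonneg (norm_nonneg p) (abs_nonneg η)]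
    rw [norm_mul, pow_one, mul_assoc, mul_assoc]
    refine mul_le_mul_of_nonneg_left (h1.trans ?_) (norm_nonneg _)
    calc _ ≤ C * Real.exp (μ * |t|) * Real.exp (|η| * |t|) * (1 + ‖p‖ + |η|) := by gcongr
      _ = _ := by rw [mul_comm |η|]; ring

theorem isCausal : 𝓜.firstOrderSystem.IsCausal := by
  intro t i j
  -- The extension in the direction `e = 0` only serves to give continuity of the influence function
  -- in `p`.
  obtain ⟨G, hG⟩ := 𝓜.exists_isExponentialExtension t i j (e := 0) (by simp)
  obtain ⟨C, hC, h⟩ := 𝓜.exists_norm_influence_le |t|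
  have hG0 : G 0 = fun p => 𝓜.firstOrderSystem.influence t p i j := funext hG.zero_eq
  refine exists_isInverseFourier (C := C) (k := 1) (hG0 ▸ hG.continuous 0) hC.le (fun p => ?_)
    (abs_nonneg t) fun e he => 𝓜.exists_isExponentialExtension t i j he.le
  refine (h t le_rfl p i j).trans ?_
  gcongr
  rw [← zpow_natCast]
  refine zpow_le_zpow_right₀ (by simp) ?_
  have := offsets_sub_mem i j
  omega

end FieldModel

/-! ### The main theorem -/

theorem mainTheorem10 {d nB nF : ℕ} (𝓜 : FieldModel d nB nF) :
    -- the system belongs to the class, with the stated smoothness offsets, and is causal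
    𝓜.firstOrderSystem.IsAdmissible (FieldModel.offsets nB nF) ∧
    𝓜.firstOrderSystem.IsCausal ∧
    -- the influence function solves the linearized, spatially Fourier transformed equations
    (∀ p : EuclideanSpace ℝ (Fin d),
      𝓜.firstOrderSystem.influence 0 p = fourierConst d • 1 ∧
      ∀ t i j, HasDerivAt (fun s => 𝓜.firstOrderSystem.influence s p i j)
        ((𝓜.firstOrderSystem.symbol p * 𝓜.firstOrderSystem.influence t p) i j) t) ∧
    -- its explicit form
    (∀ (t : ℝ) (p : EuclideanSpace ℝ (Fin d)),
      𝓜.firstOrderSystem.influence t p =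
        Matrix.fromBlocks
          (Matrix.fromBlocks
            (timeDeriv 1 (𝓜.propagatorΦ p) t) (𝓜.propagatorΦ p t)
            (timeDeriv 2 (𝓜.propagatorΦ p) t) (timeDeriv 1 (𝓜.propagatorΦ p) t))
          0 0 (𝓜.influenceΨ t p)) ∧
    (∀ (K : FirstOrderOp d nF) (M : Matrix (Fin nF) (Fin nF) ℝ),
      IsKleinGordonFactor (diracOp 𝓜.Γ 𝓜.massF) K M →
      ∀ (t : ℝ) (p : EuclideanSpace ℝ (Fin d)),
        𝓜.influenceΨ t p * (-sqAdd p (-M)) =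
          fourierConst d •
            (K.applyTime p (fun s => cosSqrt s (sqAdd p (-Mᵀ))) t *
              (diracOp 𝓜.Γ 𝓜.massF).spatial p)) ∧
    -- the estimates
    (∃ C : ℝ, 0 < C ∧ ∀ t ∈ Set.Ioo (-1 : ℝ) 1, ∀ p : EuclideanSpace ℝ (Fin d),
      (∀ i j, ‖𝓜.propagatorΦ p t i j‖ ≤ C / (1 + ‖p‖)) ∧
      (∀ i j, ‖timeDeriv 1 (𝓜.propagatorΦ p) t i j‖ ≤ C) ∧
      (∀ i j, ‖timeDeriv 2 (𝓜.propagatorΦ p) t i j‖ ≤ C * (1 + ‖p‖)) ∧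
      (∀ k l, ‖𝓜.influenceΨ t p k l‖ ≤ C)) := by
  -- The four estimates are entries of the same bound, with offset differences `-1`, `0`, `1` and
  -- `0`.
  obtain ⟨C, hC, h⟩ := 𝓜.exists_norm_influence_le 1
  refine ⟨𝓜.isAdmissible, 𝓜.isCausal, fun p => ⟨𝓜.influence_zero p, 𝓜.hasDerivAt_influence p⟩,
    𝓜.influence_eq, fun K M hKM t p => ?_, C, hC, fun t ht p => ?_⟩
  · rw [𝓜.influenceΨ_eq, smul_mul_assoc,
      exp_smul_diracGenerator_mul hKM (𝓜.Γ_symm 0) 𝓜.massF_antisymm]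
  · have h' := h t (abs_le.2 ⟨ht.1.le, ht.2.le⟩) p
    rw [𝓜.influence_eq] at h'
    refine ⟨fun i j => ?_, fun i j => ?_, fun i j => ?_, fun k l => ?_⟩
    · simpa [FieldModel.offsets, div_eq_mul_inv] using h' (Sum.inl (Sum.inl i)) (Sum.inl (Sum.inr j))
    · simpa [FieldModel.offsets] using h' (Sum.inl (Sum.inl i)) (Sum.inl (Sum.inl j))
    · simpa [FieldModel.offsets] using h' (Sum.inl (Sum.inr i)) (Sum.inl (Sum.inl j))
    · simpa [FieldModel.offsets] using h' (Sum.inr k) (Sum.inr l)
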